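/- Let $W$ be a finite Coxeter group with set of simple reflections $S$ and length function $\ell$. For $J\subseteq S$ write $W_J=\langle J\rangle$; the parabolic subgroups of $W$ are the conjugates of the subgroups $W_J$. For $w\in W$ let $J(w)\subseteq S$ be the set of generators occurring in a reduced expression of $w$. For $n>4$ identify the Coxeter group $W(D_n)$ of type $D_n$ with the group of signed permutations of $\{\pm1,\dots,\pm n\}$ sending an even number of elements of $\{1,\dots,n\}$ to negative elements, with Coxeter generators $u=(1,-2)$ and $s_i=(i,i+1)$, $1\le i\le n-1$. The cycle type of a signed permutation is the pair $\lambda=(\lambda^+,\lambda^-)$ of partitions with $|\lambda^+|+|\lambda^-|=n$, where $\lambda^+$ has a part $l$ for every positive $l$-cycle (a pair of cycles $(i_1,\dots,i_l)(-i_1,\dots,-i_l)$) and $\lambda^-$ has a part $l$ for every negative $l$-cycle (a cycle $(i_1,\dots,i_l,-i_1,\dots,-i_l)$). Call $\lambda$ non-compliant if $\lambda^+$ consists of a single odd part and $\lambda^-$ is nonempty, has only even parts, and has an even number of parts. Call a conjugacy class $C$ of $W$ non-compliant if for some odd $n>4$ there is a parabolic subgroup $W_M$, $M\subseteq S$, with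 an irreducible component $W_K$ of type $D_n$, such that $C$ contains an element of $W_M$ whose projection on $W_K\cong W(D_n)$ has as cycle type a non-compliant double partition of $n$. **Theorem.** Let $w$ be an element of a non-compliant conjugacy class of $W$. 1. If $w$ has minimal length in its conjugacy class and $J=J(w)$, then $C_{W_J}(w)$ has no complement in $C_W(w)$. 2. Consequently, for every $w$ in a non-compliant class (of minimal length or not), if $V$ is the smallest parabolic subgroup of $W$ containing $w$ (the intersection of all parabolic subgroups containing $w$), then $C_V(w)=C_W(w)\cap V$ has no complement in $C_W(w)$. -/

import Mathlib

/-! ### Signed permutations and their cycle types -/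

/-- A permutation of `{±1, …, ±n}`, with `(i, ε)` standing for the point `ε (i + 1)`, is a signed
permutation if it commutes with negation.  These form the group `W(B_n)`. -/
def signedPermGroup (n : ℕ) : Subgroup (Equiv.Perm (Fin n × ℤˣ)) where
  carrier := {σ | ∀ i ε, σ (i, -ε) = ((σ (i, ε)).1, -(σ (i, ε)).2)}
  one_mem' := by intro i ε; rfl
  mul_mem' := by
    intro σ τ hσ hτ i ε
    simp only [Set.mem_ofPred_eq, Equiv.Perm.mul_apply] at *
    rw [hτ i ε, hσ]
  inv_mem' := by
    intro σ hσ i ε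
    rw [Equiv.Perm.inv_eq_iff_eq, hσ]
    simp

theorem signedPermGroup_apply {n : ℕ} {σ : Equiv.Perm (Fin n × ℤˣ)} (hσ : σ ∈ signedPermGroup n)
    (i : Fin n) (ε : ℤˣ) : σ (i, ε) = ((σ (i, 1)).1, (σ (i, 1)).2 * ε) := by
  rcases Int.units_eq_one_or ε with rfl | rfl
  · simp
  · rw [hσ i 1]; simp

/-- The permutation `i ↦ |σ(i)|` of `[n]` underlying a signed permutation `σ`. -/
def absPerm {n : ℕ} (σ : signedPermGroup n) : Equiv.Perm (Fin n) where
  toFun i := (σ.1 (i, 1)).1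
  invFun i := (σ⁻¹.1 (i, 1)).1
  left_inv i := by
    have h := signedPermGroup_apply σ⁻¹.2 (σ.1 (i, 1)).1 (σ.1 (i, 1)).2
    have h' := congrArg Prod.fst h
    simpa using h'.symm
  right_inv i := by
    have h := signedPermGroup_apply σ.2 (σ⁻¹.1 (i, 1)).1 (σ⁻¹.1 (i, 1)).2
    have h' := congrArg Prod.fst h
    simpa using h'.symm

/-- The product over `i ∈ [n]` of the signs of `σ(i)`; it is `1` exactly when an even number of
the `σ(i)`, `i ∈ [n]`, are negative. -/
def signProd (n : ℕ) : signedPermGroup n →* ℤˣ where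
  toFun σ := ∏ i : Fin n, (σ.1 (i, 1)).2
  map_one' := by simp
  map_mul' σ τ := by
    have h : ∀ i : Fin n, ((σ * τ).1 (i, 1)).2 = (σ.1 (absPerm τ i, 1)).2 * (τ.1 (i, 1)).2 := by
      intro i
      exact congrArg Prod.snd (signedPermGroup_apply σ.2 (τ.1 (i, 1)).1 (τ.1 (i, 1)).2)
    simp only [h, Finset.prod_mul_distrib]
    rw [Equiv.prod_comp (absPerm τ) (fun i => (σ.1 (i, 1)).2)]

/-- `W(D_n)`: the signed permutations sending an even number of elements of `[n]` to `-[n]`. -/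
def evenSignedPermGroup (n : ℕ) : Subgroup (signedPermGroup n) := (signProd n).ker

/-- The cycles of a signed permutation, including the fixed points, each given by the set of
absolute values of its entries. -/
noncomputable def signedCycles {n : ℕ} (σ : signedPermGroup n) : Finset (Finset (Fin n)) := by
  classical
  exact Finset.univ.image fun i => Finset.univ.filter fun j => (absPerm σ).SameCycle i j

/-- The cycle through `i` is negative if it also passes through `-i`. -/
def InNegativeCycle {n : ℕ} (σ : signedPermGroup n) (i : Fin n) : Prop :=
  σ.1.SameCycle (i, 1) (i, -1)

/-- `λ⁺`: the lengths of the positive cycles. -/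
noncomputable def posCycleType {n : ℕ} (σ : signedPermGroup n) : Multiset ℕ := by
  classical
  exact ((signedCycles σ).filter fun c => ∀ i ∈ c, ¬ InNegativeCycle σ i).val.map Finset.card

/-- `λ⁻`: the lengths of the negative cycles. -/
noncomputable def negCycleType {n : ℕ} (σ : signedPermGroup n) : Multiset ℕ := by
  classical
  exact ((signedCycles σ).filter fun c => ∀ i ∈ c, InNegativeCycle σ i).val.map Finset.card

/-- A double partition `(λ⁺, λ⁻)` is non-compliant if `λ⁺` consists of a single odd part and `λ⁻`
is nonempty, with an even number of parts all of which are even. -/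
def IsNonCompliantDoublePartition (lamPos lamNeg : Multiset ℕ) : Prop :=
  (∃ m, Odd m ∧ lamPos = {m}) ∧ lamNeg ≠ 0 ∧ (∀ l ∈ lamNeg, Even l) ∧ Even (Multiset.card lamNeg)

/-! ### Type `D_n` -/

/-- The Coxeter matrix of type `D_n`, with the nodes labelled so that `0` stands for `u = (1, -2)`
and `j ≥ 1` for `s_j = (j, j + 1)`: the bonds are `{0, 2}` and `{j, j + 1}` for `j ≥ 1`. -/
def coxeterMatrixTypeD (n : ℕ) : CoxeterMatrix (Fin n) where
  M := Matrix.of fun i j : Fin n =>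
    if i = j then 1
    else if (i.val = 0 ∧ j.val = 2) ∨ (i.val = 2 ∧ j.val = 0)
      ∨ (1 ≤ i.val ∧ i.val + 1 = j.val) ∨ (1 ≤ j.val ∧ j.val + 1 = i.val) then 3
    else 2
  isSymm := by
    ext i j
    simp only [Matrix.transpose_apply, Matrix.of_apply]
    grind
  diagonal := by simp
  off_diagonal := by
    intro i j h
    simp only [Matrix.of_apply]
    grind

/-- The permutation with `a ↦ ε b`, `b ↦ ε a` (and `-a ↦ -ε b`, `-b ↦ -ε a`), fixing all other
points; it is `(a, b)` for `ε = 1` and `(a, -b)` for `ε = -1`. -/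
def signedSwap {n : ℕ} (a b : Fin n) (ε : ℤˣ) : Equiv.Perm (Fin n × ℤˣ) :=
  Function.Involutive.toPerm
    (fun x => if x.1 = a then (b, ε * x.2) else if x.1 = b then (a, ε * x.2) else x) (by
      rintro ⟨i, δ⟩
      have hε : ε * (ε * δ) = δ := by rw [← mul_assoc, Int.units_mul_self, one_mul]
      by_cases h1 : i = a <;> by_cases h2 : i = b <;> by_cases h3 : b = a <;>
        simp_all)

/-- The Coxeter generators of `W(D_n)`: `u = (1, -2)` for `j = 0` and `s_j = (j, j + 1)` for
`j ≥ 1`.  (The reduction modulo `n` only matters for `n ≤ 1`.) -/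
def typeDGenerator {n : ℕ} (j : Fin n) : Equiv.Perm (Fin n × ℤˣ) :=
  if j.val = 0 then signedSwap j ⟨1 % n, Nat.mod_lt _ (Fin.pos j)⟩ (-1)
  else signedSwap ⟨j.val - 1, lt_of_le_of_lt (Nat.sub_le _ _) j.isLt⟩ j 1

/-! ### Parabolic subgroups, and non-compliant classes of Coxeter groups -/

namespace CoxeterSystem

variable {B W : Type*} [Group W] {M : CoxeterMatrix B} (cs : CoxeterSystem M W)

/-- The standard parabolic subgroup `W_J`. -/
def standardParabolic (J : Set B) : Subgroup W := Subgroup.closure (cs.simple '' J)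

theorem simple_mem_standardParabolic {J : Set B} {i : B} (hi : i ∈ J) :
    cs.simple i ∈ cs.standardParabolic J :=
  Subgroup.subset_closure ⟨i, hi, rfl⟩

/-- Parabolic subgroups are the conjugates of standard parabolic subgroups. -/
def IsParabolic (P : Subgroup W) : Prop :=
  ∃ (J : Set B) (x : W), P = (cs.standardParabolic J).map (MulAut.conj x).toMonoidHom

/-- The smallest parabolic subgroup containing `w`: the intersection of all of them. -/
def parabolicClosure (w : W) : Subgroup W := sInf {P | cs.IsParabolic P ∧ w ∈ P}

/-- `J(w)`: the generators occurring in a reduced expression of `w`. -/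
def generatorSupport (w : W) : Set B :=
  {i | ∃ ω : List B, cs.IsReduced ω ∧ cs.wordProd ω = w ∧ i ∈ ω}

/-- `w` has minimal length in its conjugacy class. -/
def HasMinimalLength (w : W) : Prop := ∀ v : W, IsConj w v → cs.length w ≤ cs.length v

/-- `e` embeds the Coxeter graph of type `D_n` into that of `W` as the full subgraph on its
range `K`. -/
def IsTypeD {n : ℕ} (e : Fin n ↪ B) : Prop :=
  ∀ i j, M (e i) (e j) = coxeterMatrixTypeD n i j

/-- `φ` is the identification of `W_K`, `K = range e`, with `W(D_n)` that takes Coxeter generators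
to Coxeter generators. -/
def IsTypeDIdentification {n : ℕ} (e : Fin n ↪ B)
    (φ : cs.standardParabolic (Set.range e) ≃* evenSignedPermGroup n) : Prop :=
  ∀ j, (φ ⟨cs.simple (e j), cs.simple_mem_standardParabolic ⟨j, rfl⟩⟩).1.1 = typeDGenerator j

/-- A conjugacy class `C` is non-compliant if, for some odd `n > 4`, there is a standard parabolic
subgroup `W_I` with an irreducible component `W_K` of type `D_n` (so that
`W_I = W_K × W_{I ∖ K}`), such that `C` contains an element `p * q` of `W_I`, where `p ∈ W_K` and
`q ∈ W_{I ∖ K}`, whose projection `p` on `W_K` has as its cycle type a non-compliant double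
partition of `n`. -/
def IsNonCompliantClass (C : ConjClasses W) : Prop :=
  ∃ n : ℕ, Odd n ∧ 4 < n ∧
  ∃ (I : Set B) (e : Fin n ↪ B), IsTypeD (M := M) e ∧ Set.range e ⊆ I ∧
    (∀ i ∈ Set.range e, ∀ j ∈ I \ Set.range e, M i j = 2) ∧
  ∃ φ : cs.standardParabolic (Set.range e) ≃* evenSignedPermGroup n,
    cs.IsTypeDIdentification e φ ∧
  ∃ (p : cs.standardParabolic (Set.range e)) (q : cs.standardParabolic (I \ Set.range e)),
    ConjClasses.mk ((p : W) * (q : W)) = C ∧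
    IsNonCompliantDoublePartition (posCycleType (φ p).1) (negCycleType (φ p).1)

end CoxeterSystem

/-- The subgroup `H` of the subgroup `K` (in use, `H ≤ K`) has a complement in `K`. -/
def HasComplementIn {G : Type*} [Group G] (H K : Subgroup G) : Prop :=
  ∃ N : Subgroup K, Subgroup.IsComplement' (H.subgroupOf K) N

/-! ### Left inversions of elements of a Coxeter group -/

namespace CoxeterSystem

variable {B W : Type*} [Group W] {M : CoxeterMatrix B} (cs : CoxeterSystem M W)

/-! Let V be the parabolic closure of w and L = I ∖ K. Statement 1 is a case of statement 2, because
V = W_{J(w)} when w has minimal length. For statement 2, conjugate so that w = pq with p ∈ W_K ≅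
W(D_n), q ∈ W_L, p ∈ W_{K∖{j}}, the positive cycle of p supported on {j, …, n-1}, and w shortest
among its conjugates under W_{(K∖{j}) ∪ L} (`exists_conj_mul`). Then W_{K∖{j}} ≤ V ≤ W_{(K∖{j}) ∪
L}.

Let g ∈ W(D_n) be -1 on the positive cycle, times the restriction of p to one negative cycle
(`IsNonCompliant.exists_commute_neg`). It commutes with w, and g² lies in W_{K∖{j}} ≤ V. If C_V(w)
had a complement N, write g = vm with v ∈ V, m ∈ N. Since g normalises V, m² ∈ V ∩ N = 1, so the
W_K-component T of m is even, commutes with p and satisfies T² = 1. A parity argument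
(`IsNonCompliant.exists_apply_eq`) shows that T fixes some point a of the positive cycle with sign
+. Elements of V only carry signs + on {j, …, n-1}, so g = vm would have sign + at a, contrary to
its choice.

The bounds on V come from left inversion sets N(w): |N(w)| = ℓ(w), and N(ab) is the symmetric
difference of N(a) and aN(b)a⁻¹. They show that W_{J(w)} lies in every parabolic subgroup containing
w as soon as w is shortest under conjugation by some W_I containing it
(`standardParabolic_generatorSupport_le`). Components in W_K and W_L are well defined because W(D_n)
has trivial centre for odd n. -/

theorem simple_mul_mul_simple_eq_iff (i : B) (t : W) :
    cs.simple i * t * cs.simple i = cs.simple i ↔ t = cs.simple i := by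
  constructor
  · intro h
    have e : t = cs.simple i * (cs.simple i * t * cs.simple i) * cs.simple i := by
      simp [mul_assoc]
    rw [e, h]
    simp
  · rintro rfl
    simp

open Classical in
/-- The action of the simple reflection `s i` on signed elements of `W`: conjugate by `s i`, and
change the sign of `s i` itself. -/
noncomputable def signedConj (i : B) : Equiv.Perm (W × ZMod 2) :=
  Function.Involutive.toPerm
    (fun x => (cs.simple i * x.1 * cs.simple i, x.2 + if x.1 = cs.simple i then 1 else 0)) (by
      rintro ⟨t, ε⟩
      have h := cs.simple_mul_mul_simple_eq_iff i t
      by_cases ht : t = cs.simple i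
      · simp only [ht, if_true, simple_mul_simple_self, one_mul]
        rw [add_assoc, show (1 : ZMod 2) + 1 = 0 by decide, add_zero]
      · simp only [h, ht, if_false, add_zero]
        simp [mul_assoc])

open Classical in
theorem signedConj_apply (i : B) (t : W) (ε : ZMod 2) :
    cs.signedConj i (t, ε) =
      (cs.simple i * t * cs.simple i, ε + if t = cs.simple i then 1 else 0) := rfl

open Classical in
theorem count_leftInvSeq_cons (i : B) (ω : List B) (t : W) :
    (cs.leftInvSeq (i :: ω)).count t =
      (cs.leftInvSeq ω).count (cs.simple i * t * cs.simple i) +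
        if t = cs.simple i then 1 else 0 := by
  have h : t = MulAut.conj (cs.simple i) (cs.simple i * t * cs.simple i) := by
    simp [mul_assoc]
  rw [leftInvSeq, List.count_cons]
  nth_rw 1 [h]
  rw [List.count_map_of_injective _ _ (MulAut.conj (cs.simple i)).injective]
  simp only [beq_iff_eq, eq_comm (a := cs.simple i)]

-- The sign coordinate counts, modulo 2, the occurrences of a reflection in the left inversion
-- sequence. Once the action descends to W, this parity depends on the product of the word alone.
open Classical in
theorem prod_map_signedConj_apply (ω : List B) (t : W) (ε : ZMod 2) :
    (ω.map cs.signedConj).prod (t, ε) =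
      (cs.wordProd ω * t * (cs.wordProd ω)⁻¹,
        ε + ((cs.leftInvSeq ω).count (cs.wordProd ω * t * (cs.wordProd ω)⁻¹) : ℕ)) := by
  induction ω with
  | nil => simp
  | cons i ω ih =>
    rw [List.map_cons, List.prod_cons, Equiv.Perm.mul_apply, ih, signedConj_apply,
      count_leftInvSeq_cons, wordProd_cons]
    simp only [mul_inv_rev, inv_simple]
    have e1 : cs.simple i * cs.wordProd ω * t * ((cs.wordProd ω)⁻¹ * cs.simple i) =
        cs.simple i * (cs.wordProd ω * t * (cs.wordProd ω)⁻¹) * cs.simple i := by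
      simp only [mul_assoc]
    rw [e1, simple_mul_mul_simple_eq_iff]
    have e2 : cs.simple i * (cs.simple i * (cs.wordProd ω * t * (cs.wordProd ω)⁻¹) * cs.simple i) *
        cs.simple i = cs.wordProd ω * t * (cs.wordProd ω)⁻¹ := by
      simp [mul_assoc]
    rw [e2]
    push_cast
    rw [add_assoc]

theorem signedConj_mul_pow (i i' : B) (m : ℕ) :
    (cs.signedConj i * cs.signedConj i') ^ m =
      ((alternatingWord i i' (2 * m)).map cs.signedConj).prod := by
  induction m with
  | zero => simp [alternatingWord]
  | succ m ih =>
    rw [pow_succ, ih, show 2 * (m + 1) = 2 * m + 1 + 1 by ring, alternatingWord_succ,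
      alternatingWord_succ]
    simp

/-- The k-th entry is an alternating word of length 2k + 1, and (s s')^m = 1 makes the sequence
periodic of period m = `M i i'`. Hence each reflection occurs an even number of times, which is the
Coxeter relation for `signedConj`. -/
theorem leftInvSeq_alternatingWord_eq_append (i i' : B) :
    ∃ L : List W, cs.leftInvSeq (alternatingWord i i' (2 * M i i')) = L ++ L := by
  refine ⟨(cs.leftInvSeq (alternatingWord i i' (2 * M i i'))).take (M i i'), ?_⟩
  apply List.ext_getElem
  · simp; omega
  · intro k h1 h2
    have hk : k < 2 * M i i' := by simpa using h1
    rw [List.getElem_append]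
    split_ifs with h
    · simp
    · have hk' : M i i' ≤ k := by simpa [show M i i' ≤ 2 * M i i' by omega] using h
      have hl : min (M i i') (2 * M i i') = M i i' := by omega
      simp only [List.getElem_take, List.length_take, length_leftInvSeq, length_alternatingWord, hl]
      rw [cs.getElem_leftInvSeq_alternatingWord _ _ _ _ hk,
        cs.getElem_leftInvSeq_alternatingWord _ _ _ _ (by omega),
        prod_alternatingWord_eq_mul_pow, prod_alternatingWord_eq_mul_pow]
      have a1 : ∀ r, ¬ Even (2 * r + 1) := by intro r; simp
      have a2 : ∀ r, (2 * r + 1) / 2 = r := by intro r; omega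
      simp only [a1, a2, if_false]
      obtain ⟨r, rfl⟩ := Nat.exists_eq_add_of_le hk'
      rw [Nat.add_sub_cancel_left, pow_add, simple_mul_simple_pow', one_mul]

theorem isLiftable_signedConj : M.IsLiftable cs.signedConj := by
  classical
  intro i i'
  obtain ⟨L, hL⟩ := cs.leftInvSeq_alternatingWord_eq_append i i'
  have h1 : cs.wordProd (alternatingWord i i' (2 * M i i')) = 1 := by
    rw [prod_alternatingWord_eq_mul_pow]; simp
  ext1 ⟨t, ε⟩
  rw [signedConj_mul_pow, prod_map_signedConj_apply, hL, h1, List.count_append]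
  simp [CharTwo.add_self_eq_zero]

open Classical in
/-- The parity of the number of occurrences of `t` in the left inversion sequence of a word only
depends on the product of the word. -/
theorem count_leftInvSeq_congr {ω ω' : List B} (h : cs.wordProd ω = cs.wordProd ω') (t : W) :
    (((cs.leftInvSeq ω).count t : ℕ) : ZMod 2) = ((cs.leftInvSeq ω').count t : ℕ) := by
  have key : ∀ ω : List B, (((cs.leftInvSeq ω).count t : ℕ) : ZMod 2) =
      (cs.lift ⟨_, cs.isLiftable_signedConj⟩ (cs.wordProd ω)
        ((cs.wordProd ω)⁻¹ * t * cs.wordProd ω, 0)).2 := by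
    intro ω
    have : cs.lift ⟨_, cs.isLiftable_signedConj⟩ (cs.wordProd ω) =
        (ω.map cs.signedConj).prod := by
      rw [wordProd, map_list_prod, List.map_map]
      congr 2
      ext1 i
      exact cs.lift_apply_simple cs.isLiftable_signedConj i
    rw [this, prod_map_signedConj_apply]
    simp [mul_assoc]
  rw [key, key, h]

open Classical in
/-- The set of left inversions of `w`. -/
noncomputable def leftInversions (w : W) : Finset W :=
  (cs.leftInvSeq (cs.exists_isReduced w).choose).toFinset

theorem card_leftInversions (w : W) : (cs.leftInversions w).card = cs.length w := by
  classical
  obtain ⟨h1, h2⟩ := (cs.exists_isReduced w).choose_spec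
  rw [leftInversions, List.toFinset_card_of_nodup (h1.nodup_leftInvSeq), length_leftInvSeq]
  conv_rhs => rw [h2]
  exact h1.symm

-- Membership can be tested by parity on any word, reduced or not, since a reduced word has no
-- repeated left inversions.
open Classical in
theorem mem_leftInversions_wordProd (ω : List B) (t : W) :
    t ∈ cs.leftInversions (cs.wordProd ω) ↔ (((cs.leftInvSeq ω).count t : ℕ) : ZMod 2) = 1 := by
  obtain ⟨h1, h2⟩ := (cs.exists_isReduced (cs.wordProd ω)).choose_spec
  rw [cs.count_leftInvSeq_congr h2, leftInversions, List.mem_toFinset,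
    List.Nodup.count h1.nodup_leftInvSeq]
  split_ifs with h <;> simp [h]

theorem mem_leftInvSeq_of_mem_leftInversions {ω : List B} {t : W}
    (h : t ∈ cs.leftInversions (cs.wordProd ω)) : t ∈ cs.leftInvSeq ω := by
  classical
  rw [mem_leftInversions_wordProd] at h
  by_contra h'
  rw [List.count_eq_zero_of_not_mem h'] at h
  simp at h

theorem IsReduced.mem_leftInversions_iff {ω : List B} (hω : cs.IsReduced ω) {t : W} :
    t ∈ cs.leftInversions (cs.wordProd ω) ↔ t ∈ cs.leftInvSeq ω := by
  classical
  rw [mem_leftInversions_wordProd, List.Nodup.count hω.nodup_leftInvSeq]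
  split_ifs with h <;> simp [h]

theorem leftInvSeq_append (ω ω' : List B) :
    cs.leftInvSeq (ω ++ ω') =
      cs.leftInvSeq ω ++ (cs.leftInvSeq ω').map (MulAut.conj (cs.wordProd ω)) := by
  induction ω with
  | nil => simp
  | cons i ω ih => simp [leftInvSeq, ih, wordProd_cons]

/-- The cocycle rule: N(ab) is the symmetric difference of N(a) and aN(b)a⁻¹. Concatenating words
adds the counts, and only parity matters. -/
theorem mem_leftInversions_mul (a b t : W) :
    t ∈ cs.leftInversions (a * b) ↔
      ¬ (t ∈ cs.leftInversions a ↔ a⁻¹ * t * a ∈ cs.leftInversions b) := by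
  classical
  obtain ⟨ω, rfl⟩ := cs.wordProd_surjective a
  obtain ⟨ω', rfl⟩ := cs.wordProd_surjective b
  have h : t = MulAut.conj (cs.wordProd ω) ((cs.wordProd ω)⁻¹ * t * cs.wordProd ω) := by
    simp [mul_assoc]
  rw [← wordProd_append, mem_leftInversions_wordProd, mem_leftInversions_wordProd,
    mem_leftInversions_wordProd, leftInvSeq_append, List.count_append]
  nth_rw 2 [h]
  rw [List.count_map_of_injective _ _ (MulAut.conj (cs.wordProd ω)).injective]
  push_cast
  generalize (((cs.leftInvSeq ω).count t : ℕ) : ZMod 2) = x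
  generalize (((cs.leftInvSeq ω').count _ : ℕ) : ZMod 2) = y
  revert x y
  decide

theorem length_mul_lt_of_mem_leftInversions {w t : W} (h : t ∈ cs.leftInversions w) :
    cs.length (t * w) < cs.length w := by
  obtain ⟨ω, h1, rfl⟩ := cs.exists_isReduced w
  exact (cs.isLeftInversion_of_mem_leftInvSeq h1
    (cs.mem_leftInvSeq_of_mem_leftInversions h)).2

/-! ### Standard parabolic subgroups -/

theorem standardParabolic_mono {J K : Set B} (h : J ⊆ K) :
    cs.standardParabolic J ≤ cs.standardParabolic K :=
  Subgroup.closure_mono (Set.image_mono h)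

theorem wordProd_mem_of_forall {H : Subgroup W} {ω : List B} (h : ∀ i ∈ ω, cs.simple i ∈ H) :
    cs.wordProd ω ∈ H := by
  refine Subgroup.list_prod_mem _ fun x hx => ?_
  obtain ⟨i, hi, rfl⟩ := List.mem_map.1 hx
  exact h i hi

/-- Each entry is a letter conjugated by the product of the preceding letters, so the letters can be
recovered one at a time from the left inside `H`. -/
theorem forall_mem_leftInvSeq_iff {H : Subgroup W} {ω : List B} :
    (∀ t ∈ cs.leftInvSeq ω, t ∈ H) ↔ ∀ i ∈ ω, cs.simple i ∈ H := by
  induction ω with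
  | nil => simp
  | cons i ω ih =>
    simp only [leftInvSeq, List.forall_mem_cons, List.forall_mem_map, MulAut.conj_apply]
    refine and_congr_right fun hi => ?_
    rw [← ih]
    refine forall₂_congr fun t _ => ?_
    rw [Subgroup.mul_mem_cancel_right _ (inv_mem hi), Subgroup.mul_mem_cancel_left _ hi]

theorem exists_isReduced_of_mem_standardParabolic {J : Set B} {w : W}
    (hw : w ∈ cs.standardParabolic J) :
    ∃ ω : List B, cs.IsReduced ω ∧ w = cs.wordProd ω ∧ ∀ i ∈ ω, i ∈ J := by
  have step : ∀ i ∈ J, ∀ w : W,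
      (∃ ω : List B, cs.IsReduced ω ∧ w = cs.wordProd ω ∧ ∀ i ∈ ω, i ∈ J) →
      ∃ ω : List B, cs.IsReduced ω ∧ cs.simple i * w = cs.wordProd ω ∧ ∀ i ∈ ω, i ∈ J := by
    rintro i hi _ ⟨ω, h1, rfl, h2⟩
    have h1' : cs.length (cs.wordProd ω) = ω.length := h1
    rcases cs.length_simple_mul (cs.wordProd ω) i with h | h
    · refine ⟨i :: ω, ?_, (cs.wordProd_cons i ω).symm, by simpa using ⟨hi, h2⟩⟩
      rw [IsReduced, wordProd_cons, h, h1', List.length_cons]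
    -- Otherwise conjugation by s_i injects N(w) into N(s_i w), contradicting the drop in length.
    · have hmem : cs.simple i ∈ cs.leftInversions (cs.wordProd ω) := by
        by_contra hn
        have hmem : ∀ t ∈ cs.leftInversions (cs.wordProd ω), cs.simple i * t * cs.simple i ∈
            cs.leftInversions (cs.simple i * cs.wordProd ω) := by
          intro t ht
          have e : (cs.simple i)⁻¹ * (cs.simple i * t * cs.simple i) * cs.simple i = t := by
            simp [mul_assoc]
          rw [mem_leftInversions_mul, e, ← cs.wordProd_singleton i,
            IsReduced.mem_leftInversions_iff cs (by simp [IsReduced])]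
          simp only [ht, iff_true, leftInvSeq_singleton, List.mem_singleton, wordProd_singleton]
          intro h'
          rw [mul_eq_right] at h'
          have : t = cs.simple i := by
            rw [← mul_right_inj (cs.simple i), h']; simp
          exact hn (this ▸ ht)
        have := Finset.card_le_card_of_injOn _ hmem (by intro x _ y _ h; simpa using h)
        rw [card_leftInversions, card_leftInversions] at this
        omega
      -- Exchange: multiplying by the k-th left inversion deletes the k-th letter, so no letter
      -- outside `J` appears.
      obtain ⟨k, hk, hki⟩ := List.mem_iff_getElem.1 (cs.mem_leftInvSeq_of_mem_leftInversions hmem)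
      rw [← List.getD_eq_getElem _ 1 hk] at hki
      rw [length_leftInvSeq] at hk
      have e := cs.getD_leftInvSeq_mul_wordProd ω k
      rw [hki] at e
      refine ⟨ω.eraseIdx k, ?_, e, fun i' hi' => h2 i' (List.mem_of_mem_eraseIdx hi')⟩
      have := List.length_eraseIdx_add_one hk
      rw [IsReduced, ← e]
      omega
  refine Subgroup.closure_induction_left (p := fun w _ => ∃ ω : List B, cs.IsReduced ω ∧
    w = cs.wordProd ω ∧ ∀ i ∈ ω, i ∈ J) ⟨[], by simp [IsReduced], by simp, by simp⟩ ?_ ?_ hw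
  · rintro _ ⟨i, hi, rfl⟩ y _ hy
    exact step i hi y hy
  · rintro _ ⟨i, hi, rfl⟩ y _ hy
    rw [inv_simple]
    exact step i hi y hy

theorem leftInversions_subset_standardParabolic {J : Set B} {w : W}
    (hw : w ∈ cs.standardParabolic J) {t : W} (ht : t ∈ cs.leftInversions w) :
    t ∈ cs.standardParabolic J := by
  obtain ⟨ω, -, rfl, h⟩ := cs.exists_isReduced_of_mem_standardParabolic hw
  exact cs.forall_mem_leftInvSeq_iff.2 (fun i hi => cs.simple_mem_standardParabolic (h i hi)) t
    (cs.mem_leftInvSeq_of_mem_leftInversions ht)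

theorem mem_standardParabolic_generatorSupport (w : W) :
    w ∈ cs.standardParabolic (cs.generatorSupport w) := by
  obtain ⟨ω, h1, rfl⟩ := cs.exists_isReduced w
  exact cs.wordProd_mem_of_forall fun i hi =>
    cs.simple_mem_standardParabolic ⟨ω, h1, rfl, hi⟩

/-- An element of `W_I` whose length is minimal among its conjugates under `W_I` generates, by its
support, a subgroup of every parabolic subgroup that contains it. -/
theorem standardParabolic_generatorSupport_le {I : Set B} {w : W}
    (hw : w ∈ cs.standardParabolic I)
    (hmin : ∀ x ∈ cs.standardParabolic I, cs.length w ≤ cs.length (x * w * x⁻¹))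
    {P : Subgroup W} (hP : cs.IsParabolic P) (hwP : w ∈ P) :
    cs.standardParabolic (cs.generatorSupport w) ≤ P := by
  obtain ⟨L, y₀, hP⟩ := hP
  have hmemP : ∀ x, x ∈ P ↔ y₀⁻¹ * x * y₀ ∈ cs.standardParabolic L := by
    intro x
    rw [hP]
    constructor
    · rintro ⟨z, hz, rfl⟩
      simpa [mul_assoc] using hz
    · intro h
      exact ⟨_, h, by simp [mul_assoc]⟩
  -- Write P = yW_Ly⁻¹ with y shortest in its coset yW_L. A left inversion t ∈ P of y would give a
  -- shorter element ty = y(y⁻¹ty) of that coset.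
  obtain ⟨l₀, hl₀⟩ : ∃ l₀ : cs.standardParabolic L, ∀ l : cs.standardParabolic L,
      cs.length (y₀ * l₀) ≤ cs.length (y₀ * l) :=
    ⟨Function.argmin (fun l : cs.standardParabolic L => cs.length (y₀ * l)),
      fun l => Function.argmin_le (fun l : cs.standardParabolic L => cs.length (y₀ * l)) l⟩
  obtain ⟨y, hy⟩ : ∃ y, y = y₀ * l₀ := ⟨_, rfl⟩
  have hmemP : ∀ x, x ∈ P ↔ y⁻¹ * x * y ∈ cs.standardParabolic L := by
    intro x
    rw [hmemP, hy]
    have : (y₀ * l₀.1)⁻¹ * x * (y₀ * l₀) = l₀.1⁻¹ * (y₀⁻¹ * x * y₀) * l₀ := by group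
    rw [this, Subgroup.mul_mem_cancel_right _ l₀.2, Subgroup.mul_mem_cancel_left _ (inv_mem l₀.2)]
  have hymin : ∀ l ∈ cs.standardParabolic L, cs.length y ≤ cs.length (y * l) := by
    intro l hl
    rw [hy, mul_assoc]
    exact hl₀ (l₀ * ⟨l, hl⟩)
  have hyP : ∀ t ∈ P, t ∉ cs.leftInversions y := by
    intro t ht hty
    have h1 := cs.length_mul_lt_of_mem_leftInversions hty
    have h2 := hymin _ ((hmemP t).1 ht)
    rw [show y * (y⁻¹ * t * y) = t * y by group] at h2
    omega
  -- Symmetrically, b = a₀y is shortest in W_I y, so no left inversion of b lies in W_I. This lets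
  -- the length of w be compared with that of l = y⁻¹wy using minimality under W_I only.
  obtain ⟨a₀, ha₀⟩ : ∃ a₀ : cs.standardParabolic I, ∀ a : cs.standardParabolic I,
      cs.length (a₀ * y) ≤ cs.length (a * y) :=
    ⟨Function.argmin (fun a : cs.standardParabolic I => cs.length (a * y)),
      fun a => Function.argmin_le (fun a : cs.standardParabolic I => cs.length (a * y)) a⟩
  obtain ⟨b, hb⟩ : ∃ b, b = a₀ * y := ⟨_, rfl⟩
  have hbI : ∀ t ∈ cs.standardParabolic I, t ∉ cs.leftInversions b := by
    intro t ht htb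
    have h1 := cs.length_mul_lt_of_mem_leftInversions htb
    have h2 := ha₀ (⟨t, ht⟩ * a₀)
    rw [Subgroup.coe_mul, mul_assoc, ← hb] at h2
    exact absurd h1 (not_lt.2 h2)
  obtain ⟨l, hl⟩ : ∃ l, l = y⁻¹ * w * y := ⟨_, rfl⟩
  have hlL : l ∈ cs.standardParabolic L := hl ▸ (hmemP w).1 hwP
  have hwl : cs.length w ≤ cs.length l := by
    obtain ⟨w₂, hw₂⟩ : ∃ w₂, w₂ = a₀ * w * (a₀ : W)⁻¹ := ⟨_, rfl⟩
    have hw₂I : w₂ ∈ cs.standardParabolic I :=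
      hw₂ ▸ mul_mem (mul_mem a₀.2 hw) (inv_mem a₀.2)
    have h1 : cs.length w ≤ cs.length w₂ := hw₂ ▸ hmin _ a₀.2
    have h2 : w₂ * b = b * l := by rw [hw₂, hb, hl]; group
    have h3 := cs.length_mul_le b l
    -- N(w₂) lies in W_I while w₂N(b)w₂⁻¹ avoids it, so nothing cancels in the symmetric difference.
    have h4 : cs.length w₂ + cs.length b ≤ cs.length (w₂ * b) := by
      classical
      rw [← card_leftInversions, ← card_leftInversions, ← card_leftInversions,
        ← Finset.card_image_of_injective (cs.leftInversions b) (MulAut.conj w₂).injective]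
      have hdisj : ∀ t ∈ cs.leftInversions b, w₂ * t * w₂⁻¹ ∉ cs.leftInversions w₂ := by
        intro t ht h
        refine hbI t ?_ ht
        have := cs.leftInversions_subset_standardParabolic hw₂I h
        rwa [Subgroup.mul_mem_cancel_right _ (inv_mem hw₂I),
          Subgroup.mul_mem_cancel_left _ hw₂I] at this
      rw [← Finset.card_union_of_disjoint]
      · refine Finset.card_le_card fun t ht => ?_
        rw [mem_leftInversions_mul]
        rcases Finset.mem_union.1 ht with ht | ht
        · have hn : w₂⁻¹ * t * w₂ ∉ cs.leftInversions b := by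
            intro h
            apply hdisj _ h
            rwa [show w₂ * (w₂⁻¹ * t * w₂) * w₂⁻¹ = t by group]
          simp [ht, hn]
        · obtain ⟨r, hr, rfl⟩ := Finset.mem_image.1 ht
          rw [MulAut.conj_apply, show w₂⁻¹ * (w₂ * r * w₂⁻¹) * w₂ = r by group]
          simp [hr, hdisj r hr]
      · rw [Finset.disjoint_right]
        intro t ht
        obtain ⟨r, hr, rfl⟩ := Finset.mem_image.1 ht
        exact hdisj r hr
    rw [h2] at h4
    omega
  -- Compare N(yl) = N(wy) inside P, where neither N(y) nor its conjugate by w contributes.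
  have himg : ∀ t ∈ cs.leftInversions l, MulAut.conj y t ∈ cs.leftInversions w := by
    intro t ht
    have htL := cs.leftInversions_subset_standardParabolic hlL ht
    have htP : y * t * y⁻¹ ∈ P := by
      rw [hmemP]
      simpa [mul_assoc] using htL
    have h1 : y * t * y⁻¹ ∈ cs.leftInversions (y * l) := by
      rw [mem_leftInversions_mul, show y⁻¹ * (y * t * y⁻¹) * y = t by group]
      simp [ht, hyP _ htP]
    rw [show y * l = w * y by rw [hl]; group, mem_leftInversions_mul] at h1
    have h2 : w⁻¹ * (y * t * y⁻¹) * w ∉ cs.leftInversions y :=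
      hyP _ (mul_mem (mul_mem (inv_mem hwP) htP) hwP)
    simpa [h2] using h1
  -- Since ℓ(w) ≤ ℓ(l), the inclusion yN(l)y⁻¹ ⊆ N(w) is an equality.
  have hsub : ∀ t ∈ cs.leftInversions w, t ∈ P := by
    classical
    have heq : (cs.leftInversions l).image (MulAut.conj y) = cs.leftInversions w := by
      refine Finset.eq_of_subset_of_card_le ?_ ?_
      · intro t ht
        obtain ⟨r, hr, rfl⟩ := Finset.mem_image.1 ht
        exact himg r hr
      · rw [Finset.card_image_of_injective _ (MulAut.conj y).injective, card_leftInversions,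
          card_leftInversions]
        exact hwl
    intro t ht
    rw [← heq] at ht
    obtain ⟨r, hr, rfl⟩ := Finset.mem_image.1 ht
    rw [hmemP]
    simpa [mul_assoc] using cs.leftInversions_subset_standardParabolic hlL hr
  rw [standardParabolic, Subgroup.closure_le]
  rintro _ ⟨i, ⟨ω, hω, rfl, hi⟩, rfl⟩
  refine cs.forall_mem_leftInvSeq_iff.1 (fun t ht => ?_) i hi
  exact hsub t ((IsReduced.mem_leftInversions_iff cs hω).2 ht)

/-! ### Parabolic closures -/

theorem isParabolic_standardParabolic (J : Set B) : cs.IsParabolic (cs.standardParabolic J) :=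
  ⟨J, 1, by ext; simp⟩

theorem parabolicClosure_eq_of_forall_length_le {I : Set B} {w : W}
    (hw : w ∈ cs.standardParabolic I)
    (hmin : ∀ x ∈ cs.standardParabolic I, cs.length w ≤ cs.length (x * w * x⁻¹)) :
    cs.parabolicClosure w = cs.standardParabolic (cs.generatorSupport w) :=
  le_antisymm
    (sInf_le ⟨cs.isParabolic_standardParabolic _, cs.mem_standardParabolic_generatorSupport w⟩)
    (le_sInf fun _ hP => cs.standardParabolic_generatorSupport_le hw hmin hP.1 hP.2)

theorem HasMinimalLength.parabolicClosure_eq {w : W} (hw : cs.HasMinimalLength w) :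
    cs.parabolicClosure w = cs.standardParabolic (cs.generatorSupport w) := by
  refine cs.parabolicClosure_eq_of_forall_length_le (I := Set.univ) ?_
    fun x _ => hw _ (isConj_iff.2 ⟨x, rfl⟩)
  rw [standardParabolic, Set.image_univ, subgroup_closure_range_simple]
  trivial

theorem IsParabolic.map_conj {P : Subgroup W} (hP : cs.IsParabolic P) (x : W) :
    cs.IsParabolic (P.map (MulAut.conj x).toMonoidHom) := by
  obtain ⟨J, y, rfl⟩ := hP
  refine ⟨J, x * y, ?_⟩
  rw [Subgroup.map_map]
  congr 1
  ext z
  simp [mul_assoc]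

theorem conj_mem_parabolicClosure {w v : W} (x : W) (hv : v ∈ cs.parabolicClosure w) :
    x * v * x⁻¹ ∈ cs.parabolicClosure (x * w * x⁻¹) := by
  rw [parabolicClosure, Subgroup.mem_sInf] at *
  rintro P ⟨hP, hwP⟩
  have := hv _ ⟨IsParabolic.map_conj cs hP x⁻¹, ⟨_, hwP, by simp [mul_assoc]⟩⟩
  obtain ⟨z, hz, rfl⟩ := this
  simpa [mul_assoc] using hz

end CoxeterSystem

/-! ### Signed permutations in terms of absolute values and signs -/

namespace SignedPerm

variable {n : ℕ}

/-- The sign of `σ(i)`. -/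
def sgn (σ : signedPermGroup n) (i : Fin n) : ℤˣ := (σ.1 (i, 1)).2

theorem apply_eq (σ : signedPermGroup n) (i : Fin n) (ε : ℤˣ) :
    σ.1 (i, ε) = (absPerm σ i, sgn σ i * ε) :=
  signedPermGroup_apply σ.2 i ε

theorem absPerm_mul (σ τ : signedPermGroup n) : absPerm (σ * τ) = absPerm σ * absPerm τ := by
  ext1 i
  change (σ.1 (τ.1 (i, 1))).1 = _
  rw [apply_eq τ, apply_eq σ]
  rfl

theorem absPerm_one : absPerm (1 : signedPermGroup n) = 1 := rfl

theorem absPerm_inv (σ : signedPermGroup n) : absPerm σ⁻¹ = (absPerm σ)⁻¹ := by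
  rw [eq_inv_iff_mul_eq_one, ← absPerm_mul, inv_mul_cancel, absPerm_one]

theorem sgn_mul (σ τ : signedPermGroup n) (i : Fin n) :
    sgn (σ * τ) i = sgn σ (absPerm τ i) * sgn τ i :=
  congrArg Prod.snd (apply_eq σ (τ.1 (i, 1)).1 (τ.1 (i, 1)).2)

theorem sgn_one (i : Fin n) : sgn (1 : signedPermGroup n) i = 1 := rfl

theorem signProd_eq (σ : signedPermGroup n) : signProd n σ = ∏ i, sgn σ i := rfl

theorem ext_absPerm_sgn {σ τ : signedPermGroup n} (h : ∀ i, absPerm σ i = absPerm τ i)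
    (h' : ∀ i, sgn σ i = sgn τ i) : σ = τ := by
  apply Subtype.ext
  ext1 ⟨i, ε⟩
  rw [apply_eq, apply_eq, h, h']

/-- The signed permutation `i ↦ s(i) π(i)`. -/
def ofPermSigns (π : Equiv.Perm (Fin n)) (s : Fin n → ℤˣ) : signedPermGroup n :=
  ⟨{ toFun := fun x => (π x.1, s x.1 * x.2)
     invFun := fun x => (π⁻¹ x.1, s (π⁻¹ x.1) * x.2)
     left_inv := by
       rintro ⟨i, ε⟩
       simp [← mul_assoc]
     right_inv := by
       rintro ⟨i, ε⟩
       simp [← mul_assoc] }, by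
    intro i ε
    simp⟩

@[simp] theorem absPerm_ofPermSigns (π : Equiv.Perm (Fin n)) (s : Fin n → ℤˣ) :
    absPerm (ofPermSigns π s) = π := rfl

@[simp] theorem sgn_ofPermSigns (π : Equiv.Perm (Fin n)) (s : Fin n → ℤˣ) (i : Fin n) :
    sgn (ofPermSigns π s) i = s i := by
  simp [sgn, ofPermSigns]

theorem absPerm_mul_apply_comm {σ τ : signedPermGroup n} (h : σ * τ = τ * σ) (i : Fin n) :
    absPerm σ (absPerm τ i) = absPerm τ (absPerm σ i) := by
  rw [← Equiv.Perm.mul_apply, ← absPerm_mul, h, absPerm_mul, Equiv.Perm.mul_apply]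

/-! ### Negative cycles -/

theorem sameCycle_congr {σ : signedPermGroup n} {i : Fin n} (ε δ : ℤˣ) :
    σ.1.SameCycle (i, ε) (i, -ε) → σ.1.SameCycle (i, δ) (i, -δ) := by
  intro h
  rcases Int.units_eq_one_or ε with rfl | rfl <;> rcases Int.units_eq_one_or δ with rfl | rfl <;>
    first
    | exact h
    | simpa using h.symm

theorem inNegativeCycle_conj_iff (τ σ : signedPermGroup n) (i : Fin n) :
    InNegativeCycle (τ * σ * τ⁻¹) (absPerm τ i) ↔ InNegativeCycle σ i := by
  have h : InNegativeCycle (τ * σ * τ⁻¹) (absPerm τ i) ↔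
      (τ * σ * τ⁻¹).1.SameCycle (absPerm τ i, sgn τ i) (absPerm τ i, -sgn τ i) :=
    ⟨sameCycle_congr _ _, sameCycle_congr _ _⟩
  rw [h]
  have e1 := apply_eq τ i 1
  have e2 := apply_eq τ i (-1)
  rw [mul_one] at e1
  rw [mul_neg_one] at e2
  rw [← e1, ← e2]
  have := Equiv.Perm.sameCycle_conj (f := σ.1) (g := τ.1) (x := τ.1 (i, 1)) (y := τ.1 (i, -1))
  rwa [Equiv.Perm.inv_def, Equiv.symm_apply_apply, Equiv.symm_apply_apply] at this

theorem inNegativeCycle_apply_of_commute {σ τ : signedPermGroup n} (h : τ * σ = σ * τ)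
    (i : Fin n) : InNegativeCycle σ (absPerm τ i) ↔ InNegativeCycle σ i := by
  have := inNegativeCycle_conj_iff τ σ i
  rwa [h, mul_inv_cancel_right] at this

theorem inNegativeCycle_apply (σ : signedPermGroup n) (i : Fin n) :
    InNegativeCycle σ (absPerm σ i) ↔ InNegativeCycle σ i :=
  inNegativeCycle_apply_of_commute rfl i

theorem eq_of_sameCycle {α β : Type*} {π : Equiv.Perm α} {f : α → β} (hf : ∀ i, f (π i) = f i)
    {i j : α} (h : π.SameCycle i j) : f i = f j := by
  obtain ⟨k, rfl⟩ := h
  have hf' : ∀ i, f (π⁻¹ i) = f i := fun i => by rw [← hf (π⁻¹ i)]; simp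
  induction k with
  | zero => rfl
  | succ k ih => rw [add_comm, zpow_one_add, Equiv.Perm.mul_apply, hf, ih]
  | pred k ih =>
    rw [sub_eq_add_neg, add_comm, zpow_add, zpow_neg_one, Equiv.Perm.mul_apply, hf', ih]

theorem inNegativeCycle_congr {σ : signedPermGroup n} {i j : Fin n}
    (h : (absPerm σ).SameCycle i j) : InNegativeCycle σ i ↔ InNegativeCycle σ j :=
  iff_of_eq (eq_of_sameCycle (fun i => propext (inNegativeCycle_apply σ i)) h)

theorem pow_apply_eq (σ : signedPermGroup n) (i : Fin n) (k : ℕ) (ε : ℤˣ) :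
    (σ.1 ^ k) (i, ε) =
      ((absPerm σ ^ k) i, (∏ r ∈ Finset.range k, sgn σ ((absPerm σ ^ r) i)) * ε) := by
  induction k with
  | zero => simp
  | succ k ih =>
    rw [pow_succ', Equiv.Perm.mul_apply, ih, apply_eq, pow_succ', Equiv.Perm.mul_apply,
      Finset.prod_range_succ, mul_comm (∏ r ∈ Finset.range k, _) (sgn σ _), mul_assoc]

open Classical in
/-- The product of the signs along a negative cycle is `-1`. -/
theorem prod_sgn_of_inNegativeCycle {σ : signedPermGroup n} {i : Fin n}
    (hi : InNegativeCycle σ i) :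
    ∏ j with (absPerm σ).SameCycle i j, sgn σ j = -1 := by
  set c : Finset (Fin n) := Finset.univ.filter fun j => (absPerm σ).SameCycle i j with hc
  have hic : i ∈ c := by simp [hc, Equiv.Perm.SameCycle.refl]
  have hcyc : (absPerm σ).IsCycleOn c := by
    refine ⟨(absPerm σ).bijOn fun x => ?_, fun x hx y hy => ?_⟩
    · simp [hc]
    · simp only [hc, Finset.coe_filter, Finset.mem_univ, true_and, Set.mem_ofPred_eq] at hx hy
      exact hx.symm.trans hy
  have himg : (Finset.range c.card).image (fun r => (absPerm σ ^ r) i) = c := by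
    refine Finset.Subset.antisymm ?_ fun b hb => ?_
    · intro b hb
      obtain ⟨r, -, rfl⟩ := Finset.mem_image.1 hb
      simp only [hc, Finset.mem_filter, Finset.mem_univ, true_and]
      exact ⟨r, by simp⟩
    · obtain ⟨r, hr, rfl⟩ := hcyc.exists_pow_eq hic hb
      exact Finset.mem_image.2 ⟨r, Finset.mem_range.2 hr, rfl⟩
  have hinj : Set.InjOn (fun r => (absPerm σ ^ r) i) (Finset.range c.card : Set ℕ) := by
    apply Finset.injOn_of_card_image_eq
    rw [himg, Finset.card_range]
  have hprod : ∏ r ∈ Finset.range c.card, sgn σ ((absPerm σ ^ r) i) = ∏ j ∈ c, sgn σ j := by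
    rw [← Finset.prod_image (f := sgn σ) hinj, himg]
  -- If the product were 1, going once around would fix (i, 1), and so would every power of σ
  -- bringing i back to ±i; -i would never be reached.
  rcases Int.units_eq_one_or (∏ j ∈ c, sgn σ j) with h | h
  · exfalso
    have h1 : (σ.1 ^ c.card) (i, 1) = (i, 1) := by
      rw [pow_apply_eq, hprod, h, hcyc.pow_card_apply hic, one_mul]
    obtain ⟨k, hk⟩ := Equiv.Perm.SameCycle.exists_nat_pow_eq hi
    have h2 : (absPerm σ ^ k) i = i := by
      rw [pow_apply_eq] at hk
      exact congrArg Prod.fst hk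
    obtain ⟨q, rfl⟩ := (hcyc.pow_apply_eq hic).1 h2
    have h3 : ((σ.1 ^ c.card) ^ q) (i, 1) = (i, 1) :=
      Equiv.Perm.pow_apply_eq_self_of_apply_eq_self h1 q
    rw [pow_mul, h3] at hk
    exact absurd (congrArg Prod.snd hk) (by simp)
  · exact h

/-! ### Signed permutations of non-compliant cycle type -/

open Classical in
/-- A reformulation, convenient for conjugation, of the non-compliance of the cycle type of `σ`. -/
structure IsNonCompliant (σ : signedPermGroup n) : Prop where
  odd_card : Odd (Finset.univ.filter fun i => ¬ InNegativeCycle σ i).card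
  exists_inNegativeCycle : ∃ i, InNegativeCycle σ i
  -- A sign function constant on cycles contributes 1 over each even negative cycle, and its value
  -- at a over the single odd positive cycle.
  prod_eq : ∀ f : Fin n → ℤˣ, (∀ i, f (absPerm σ i) = f i) →
    ∀ a, ¬ InNegativeCycle σ a → ∏ i, f i = f a

theorem isNonCompliant_of_cycleType {σ : signedPermGroup n}
    (h : IsNonCompliantDoublePartition (posCycleType σ) (negCycleType σ)) :
    IsNonCompliant σ := by
  classical
  obtain ⟨⟨m, hm, hpos⟩, hne, heven, -⟩ := h
  have hcyc : signedCycles σ =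
      Finset.univ.image fun i => Finset.univ.filter fun j => (absPerm σ).SameCycle i j := by
    unfold signedCycles; congr!
  have hpos' : ((signedCycles σ).filter fun c => ∀ i ∈ c, ¬ InNegativeCycle σ i).val.map
      Finset.card = {m} := by
    rw [← hpos]; unfold posCycleType; congr!
  have hneg' : negCycleType σ = ((signedCycles σ).filter fun c =>
      ∀ i ∈ c, InNegativeCycle σ i).val.map Finset.card := by
    unfold negCycleType; congr!
  set cyc : Fin n → Finset (Fin n) :=
    fun i => Finset.univ.filter fun j => (absPerm σ).SameCycle i j with hcycdef
  have hself : ∀ i, i ∈ cyc i := fun i => by simp [hcycdef, Equiv.Perm.SameCycle.refl]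
  have hmem : ∀ i j, j ∈ cyc i ↔ (absPerm σ).SameCycle i j := fun i j => by simp [hcycdef]
  have hcyceq : ∀ i j, j ∈ cyc i → cyc j = cyc i := by
    intro i j hij
    rw [hmem] at hij
    ext k
    rw [hmem, hmem]
    exact ⟨fun h => hij.trans h, fun h => hij.symm.trans h⟩
  obtain ⟨c, hc, hcm⟩ := Multiset.map_eq_singleton.1 hpos'
  have hcA : ∀ i, i ∈ c ↔ ¬ InNegativeCycle σ i := by
    intro i
    constructor
    · have : c ∈ (signedCycles σ).filter fun c => ∀ i ∈ c, ¬ InNegativeCycle σ i := by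
        rw [← Finset.mem_val, hc]; simp
      exact (Finset.mem_filter.1 this).2 i
    · intro hi
      have : cyc i ∈ (signedCycles σ).filter fun c => ∀ i ∈ c, ¬ InNegativeCycle σ i := by
        rw [Finset.mem_filter, hcyc]
        refine ⟨Finset.mem_image_of_mem _ (Finset.mem_univ i), fun j hj => ?_⟩
        rwa [← inNegativeCycle_congr ((hmem _ _).1 hj)]
      rw [← Finset.mem_val, hc, Multiset.mem_singleton] at this
      rw [← this]
      exact hself i
  refine ⟨?_, ?_, ?_⟩
  · have : (Finset.univ.filter fun i => ¬ InNegativeCycle σ i) = c := by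
      ext i; simp [hcA]
    rw [this, hcm]
    exact hm
  · rw [hneg'] at hne
    obtain ⟨l, hl⟩ := Multiset.exists_mem_of_ne_zero hne
    obtain ⟨d, hd, -⟩ := Multiset.mem_map.1 hl
    rw [Finset.mem_val, Finset.mem_filter, hcyc] at hd
    obtain ⟨hd1, hd2⟩ := hd
    obtain ⟨i, -, rfl⟩ := Finset.mem_image.1 hd1
    exact ⟨i, hd2 i (hself i)⟩
  · intro f hf a ha
    have hfib : ∀ d ∈ signedCycles σ, ∀ i ∈ d,
        ∏ k ∈ Finset.univ.filter (fun k => cyc k = d), f k = f i ^ d.card := by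
      intro d hd i hi
      rw [hcyc] at hd
      obtain ⟨j, -, rfl⟩ := Finset.mem_image.1 hd
      have e : Finset.univ.filter (fun k => cyc k = cyc j) = cyc j := by
        ext k
        simp only [Finset.mem_filter, Finset.mem_univ, true_and]
        exact ⟨fun h => h ▸ hself k, fun h => hcyceq _ _ h⟩
      rw [← hcyceq j i hi]
      rw [← hcyceq j i hi] at e
      rw [e, Finset.prod_congr rfl (g := fun _ => f i), Finset.prod_const]
      intro k hk
      exact (eq_of_sameCycle hf ((hmem _ _).1 hk)).symm
    have hmaps : ∀ i ∈ (Finset.univ : Finset (Fin n)), cyc i ∈ signedCycles σ := by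
      intro i _
      rw [hcyc]
      exact Finset.mem_image_of_mem _ (Finset.mem_univ i)
    have hca : cyc a = c := by
      ext i
      rw [hmem, hcA]
      refine ⟨fun h => by rwa [← inNegativeCycle_congr h], fun h => ?_⟩
      have h1 : cyc a ∈ (signedCycles σ).filter fun c => ∀ i ∈ c, ¬ InNegativeCycle σ i := by
        refine Finset.mem_filter.2 ⟨hmaps a (Finset.mem_univ a), fun j hj => ?_⟩
        rwa [← inNegativeCycle_congr ((hmem _ _).1 hj)]
      rw [← Finset.mem_val, hc, Multiset.mem_singleton] at h1
      rw [← hmem, h1, hcA]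
      exact h
    rw [← Finset.prod_fiberwise_of_maps_to hmaps, Finset.prod_eq_single c]
    · rw [hfib c (hca ▸ hmaps a (Finset.mem_univ a)) a ((hcA a).2 ha), hcm]
      obtain ⟨r, rfl⟩ := hm
      rw [pow_succ, pow_mul, Int.units_sq, one_pow, one_mul]
    · intro d hd hdc
      have hd' := hd
      rw [hcyc] at hd'
      obtain ⟨i, -, rfl⟩ := Finset.mem_image.1 hd'
      rw [hfib _ hd i (hself i)]
      have hi : InNegativeCycle σ i := by
        by_contra hi
        refine hdc (Eq.symm ?_)
        rw [← hca]
        exact hcyceq i a ((hmem _ _).2 (((hmem _ _).1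
          (by rw [hca]; exact (hcA i).2 hi : i ∈ cyc a)).symm))
      obtain ⟨r, hr⟩ := heven (cyc i).card (by
        rw [hneg']
        refine Multiset.mem_map_of_mem _ (Finset.mem_filter.2 ⟨hd, fun j hj => ?_⟩)
        rwa [← inNegativeCycle_congr ((hmem _ _).1 hj)])
      rw [show (Finset.univ.filter fun j => (absPerm σ).SameCycle i j).card = r + r from hr,
        pow_add, ← mul_pow, Int.units_mul_self, one_pow]
    · intro hc'
      exact absurd (hca ▸ hmaps a (Finset.mem_univ a)) hc'

theorem IsNonCompliant.conj {σ : signedPermGroup n} (h : IsNonCompliant σ)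
    (τ : signedPermGroup n) : IsNonCompliant (τ * σ * τ⁻¹) := by
  classical
  have hneg : ∀ i, InNegativeCycle (τ * σ * τ⁻¹) i ↔ InNegativeCycle σ ((absPerm τ).symm i) := by
    intro i
    rw [← inNegativeCycle_conj_iff τ σ, Equiv.apply_symm_apply]
  refine ⟨?_, ?_, ?_⟩
  · have : (Finset.univ.filter fun i => ¬ InNegativeCycle (τ * σ * τ⁻¹) i) =
        (Finset.univ.filter fun i => ¬ InNegativeCycle σ i).map (absPerm τ).toEmbedding := by
      ext i
      simp [hneg, Finset.mem_map_equiv]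
    rw [this, Finset.card_map]
    exact h.odd_card
  · obtain ⟨i, hi⟩ := h.exists_inNegativeCycle
    exact ⟨absPerm τ i, (inNegativeCycle_conj_iff τ σ i).2 hi⟩
  · intro f hf a ha
    rw [hneg] at ha
    have := h.prod_eq (f ∘ absPerm τ) (fun i => ?_) _ ha
    · simpa [Equiv.prod_comp (absPerm τ) f] using this
    · have := hf (absPerm τ i)
      simpa [absPerm_mul, absPerm_inv] using this

theorem IsNonCompliant.exists_not_inNegativeCycle {σ : signedPermGroup n}
    (h : IsNonCompliant σ) : ∃ a, ¬ InNegativeCycle σ a := by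
  classical
  obtain ⟨a, ha⟩ := Finset.card_pos.1 h.odd_card.pos
  exact ⟨a, (Finset.mem_filter.1 ha).2⟩

/-- By `prod_eq`, an invariant sign function has the same value at all positive points; apply this
to the one equal to -1 exactly on the cycle of a. -/
theorem IsNonCompliant.sameCycle {σ : signedPermGroup n} (h : IsNonCompliant σ) {a b : Fin n}
    (ha : ¬ InNegativeCycle σ a) (hb : ¬ InNegativeCycle σ b) : (absPerm σ).SameCycle a b := by
  classical
  let f : Fin n → ℤˣ := fun i => if (absPerm σ).SameCycle a i then -1 else 1
  have h1 : ∀ i, f (absPerm σ i) = f i := by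
    intro i; simp [f]
  have h2 := (h.prod_eq _ h1 a ha).symm.trans (h.prod_eq _ h1 b hb)
  by_contra hab
  simp [f, hab, Equiv.Perm.SameCycle.refl] at h2

/-- An even signed involution commuting with `σ` fixes a point of the positive cycle of `σ`. -/
theorem IsNonCompliant.exists_apply_eq {σ : signedPermGroup n} (h : IsNonCompliant σ)
    {τ : signedPermGroup n} (hτ : τ * τ = 1) (heven : signProd n τ = 1) (hcomm : τ * σ = σ * τ) :
    ∃ a, ¬ InNegativeCycle σ a ∧ absPerm τ a = a ∧ sgn τ a = 1 := by
  classical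
  have hinv : ∀ i, absPerm τ (absPerm τ i) = i := by
    intro i
    rw [← Equiv.Perm.mul_apply, ← absPerm_mul, hτ, absPerm_one, Equiv.Perm.one_apply]
  have hsgn : ∀ i, sgn τ (absPerm τ i) * sgn τ i = 1 := by
    intro i
    rw [← sgn_mul, hτ, sgn_one]
  obtain ⟨a, ha, hfix⟩ : ∃ a, ¬ InNegativeCycle σ a ∧ absPerm τ a = a := by
    -- An involution without fixed points on the positive cycle would force its length to be even.
    by_contra! hno
    have h1 : ∏ i with ¬ InNegativeCycle σ i, (-1 : ℤˣ) = 1 := by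
      refine Finset.prod_involution (fun i _ => absPerm τ i) (fun _ _ => by simp) ?_ ?_ ?_
      · intro i hi _
        exact hno i (Finset.mem_filter.1 hi).2
      · intro i hi
        rw [Finset.mem_filter, inNegativeCycle_apply_of_commute hcomm]
        exact ⟨Finset.mem_univ _, (Finset.mem_filter.1 hi).2⟩
      · intro i _
        exact hinv i
    rw [Finset.prod_const, h.odd_card.neg_one_pow] at h1
    exact absurd h1 (by decide)
  refine ⟨a, ha, hfix, ?_⟩
  -- Keep only the signs of τ at its fixed points. They are constant along cycles of σ, because τ
  -- commutes with σ, so `prod_eq` reduces their product to the sign at a.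
  let f : Fin n → ℤˣ := fun i => if absPerm τ i = i then sgn τ i else 1
  have hf : ∀ i, f (absPerm σ i) = f i := by
    intro i
    simp only [f, absPerm_mul_apply_comm hcomm, EmbeddingLike.apply_eq_iff_eq]
    split_ifs with hi
    · have := congrArg (fun ρ => sgn ρ i) hcomm
      simp only [sgn_mul, hi] at this
      rw [mul_comm] at this
      exact mul_left_cancel this
    · rfl
  have h1 := h.prod_eq _ hf a ha
  simp only [f, if_pos hfix] at h1
  -- On a 2-cycle of `absPerm τ` the two signs multiply to 1 because τ² = 1.
  have h2 : ∏ i, (if absPerm τ i = i then 1 else sgn τ i) = 1 := by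
    refine Finset.prod_involution (fun i _ => absPerm τ i) ?_ ?_ (by simp) fun i _ => hinv i
    · intro i _
      by_cases hi : absPerm τ i = i
      · simp [hi]
      · rw [hinv, if_neg hi, if_neg (Ne.symm hi), mul_comm]
        exact hsgn i
    · intro i _ hi h'
      simp [h'] at hi
  have h3 : ∏ i, sgn τ i =
      (∏ i, if absPerm τ i = i then sgn τ i else 1) *
        ∏ i, if absPerm τ i = i then 1 else sgn τ i := by
    rw [← Finset.prod_mul_distrib]
    refine Finset.prod_congr rfl fun i _ => ?_
    split_ifs <;> simp
  rw [signProd_eq, h3, h2, mul_one] at heven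
  exact h1.symm.trans heven

/-- There is an even signed permutation commuting with `σ` that acts as `-1` on the positive cycle
of `σ`. -/
theorem IsNonCompliant.exists_commute_neg {σ : signedPermGroup n} (h : IsNonCompliant σ) :
    ∃ g : signedPermGroup n, signProd n g = 1 ∧ g * σ = σ * g ∧
      ∀ a, ¬ InNegativeCycle σ a → absPerm g a = a ∧ sgn g a = -1 := by
  classical
  obtain ⟨i₀, hi₀⟩ := h.exists_inNegativeCycle
  have hpos : ∀ a, ¬ InNegativeCycle σ a → ¬ (absPerm σ).SameCycle i₀ a :=
    fun a ha hs => ha ((inNegativeCycle_congr hs).1 hi₀)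
  have hs : ∀ i, (absPerm σ).SameCycle i₀ (absPerm σ i) ↔ (absPerm σ).SameCycle i₀ i := by
    intro i; simp
  -- Negation of the positive cycle alone has sign product -1, its length being odd. Multiplying by
  -- σ restricted to the negative cycle of i₀, also of sign product -1, restores evenness.
  let s : Fin n → ℤˣ := fun i => (if InNegativeCycle σ i then 1 else -1) *
    if (absPerm σ).SameCycle i₀ i then sgn σ i else 1
  refine ⟨ofPermSigns ((absPerm σ).cycleOf i₀) s, ?_, ?_, ?_⟩
  · simp only [signProd_eq, sgn_ofPermSigns, s]
    rw [Finset.prod_mul_distrib, Finset.prod_ite, Finset.prod_const_one, one_mul,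
      Finset.prod_const, h.odd_card.neg_one_pow, Finset.prod_ite, Finset.prod_const_one, mul_one,
      prod_sgn_of_inNegativeCycle hi₀]
    simp
  · apply ext_absPerm_sgn
    · intro i
      simp only [absPerm_mul, absPerm_ofPermSigns, Equiv.Perm.mul_apply, Equiv.Perm.cycleOf_apply,
        hs]
      split_ifs <;> rfl
    · intro i
      simp only [sgn_mul, absPerm_ofPermSigns, sgn_ofPermSigns, s, Equiv.Perm.cycleOf_apply, hs,
        inNegativeCycle_apply]
      split_ifs <;> simp [mul_comm]
  · intro a ha
    simp [s, ha, Equiv.Perm.cycleOf_apply, hpos a ha]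

/-! ### Signed transpositions -/

theorem signedSwap_apply (a b : Fin n) (ε : ℤˣ) (x : Fin n × ℤˣ) :
    signedSwap a b ε x =
      if x.1 = a then (b, ε * x.2) else if x.1 = b then (a, ε * x.2) else x := rfl

theorem signedSwap_comm (a b : Fin n) (ε : ℤˣ) : signedSwap a b ε = signedSwap b a ε := by
  ext1 x
  rw [signedSwap_apply, signedSwap_apply]
  split_ifs <;> simp_all

theorem signedSwap_conj {a b c : Fin n} (hab : a ≠ b) (hac : a ≠ c) (hbc : b ≠ c) (ε : ℤˣ) :
    signedSwap b c 1 * signedSwap a b ε * signedSwap b c 1 = signedSwap a c ε := by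
  ext1 ⟨i, δ⟩
  simp only [Equiv.Perm.mul_apply, signedSwap_apply]
  split_ifs <;> simp_all

/-- `signedSwap` as an element of the group of signed permutations. -/
def signedTransposition (a b : Fin n) (ε : ℤˣ) : signedPermGroup n :=
  ⟨signedSwap a b ε, by
    intro i δ
    simp only [signedSwap_apply]
    split_ifs <;> simp⟩

theorem absPerm_signedTransposition (a b : Fin n) (ε : ℤˣ) :
    absPerm (signedTransposition a b ε) = Equiv.swap a b := by
  ext1 i
  change (signedSwap a b ε (i, 1)).1 = _
  rw [signedSwap_apply, Equiv.swap_apply_def]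
  split_ifs <;> rfl

theorem sgn_signedTransposition (a b : Fin n) (ε : ℤˣ) (i : Fin n) :
    sgn (signedTransposition a b ε) i = if i = a ∨ i = b then ε else 1 := by
  change (signedSwap a b ε (i, 1)).2 = _
  rw [signedSwap_apply]
  split_ifs <;> simp_all

theorem signProd_signedTransposition {a b : Fin n} (hab : a ≠ b) (ε : ℤˣ) :
    signProd n (signedTransposition a b ε) = 1 := by
  rw [signProd_eq]
  simp only [sgn_signedTransposition]
  rw [Finset.prod_ite, Finset.prod_const_one, mul_one, Finset.prod_const]
  have : (Finset.univ.filter fun i => i = a ∨ i = b) = {a, b} := by ext; simp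
  rw [this, Finset.card_pair hab, Int.units_sq]

/-- For odd `n > 2` the centre of `W(D_n)` is trivial. -/
theorem eq_one_of_commute_signedTransposition (hodd : Odd n) (hn : 2 < n)
    {σ : signedPermGroup n} (heven : signProd n σ = 1)
    (hcomm : ∀ a b : Fin n, a ≠ b →
      σ * signedTransposition a b 1 = signedTransposition a b 1 * σ) : σ = 1 := by
  have habs : ∀ i, absPerm σ i = i := by
    intro i
    by_contra hi
    -- The transposition (i b) fixes |σ(i)|, so commuting with it forces |σ(b)| = |σ(i)|.
    obtain ⟨b, hb⟩ : ∃ b : Fin n, b ∉ ({i, absPerm σ i} : Finset (Fin n)) := by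
      by_contra! hall
      have h1 : Fintype.card (Fin n) ≤ 2 :=
        (Finset.card_le_card fun x _ => hall x).trans Finset.card_le_two
      rw [Fintype.card_fin] at h1
      omega
    simp only [Finset.mem_insert, Finset.mem_singleton, not_or] at hb
    have h1 := absPerm_mul_apply_comm (hcomm i b (Ne.symm hb.1)) i
    rw [absPerm_signedTransposition, Equiv.swap_apply_left,
      Equiv.swap_apply_of_ne_of_ne hi (Ne.symm hb.2)] at h1
    exact hb.1 ((absPerm σ).injective h1)
  have hconst : ∀ a b, sgn σ a = sgn σ b := by
    intro a b
    rcases eq_or_ne a b with rfl | hab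
    · rfl
    · have := congrArg (fun ρ => sgn ρ b) (hcomm a b hab)
      simpa [sgn_mul, sgn_signedTransposition, absPerm_signedTransposition] using this
  apply ext_absPerm_sgn
  · exact habs
  · intro i
    rw [sgn_one, ← heven, signProd_eq, Finset.prod_congr rfl fun j _ => hconst j i,
      Finset.prod_const, Finset.card_univ, Fintype.card_fin]
    obtain ⟨r, rfl⟩ := hodd
    rw [pow_succ, pow_mul, Int.units_sq, one_pow, one_mul]

/-! ### Maximal standard parabolic subgroups of `W(D_n)` -/

theorem typeDGenerator_zero {k l : Fin n} (hk : k.val = 0) (hl : l.val = 1) :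
    typeDGenerator k = signedSwap k l (-1) := by
  have hn : 1 < n := hl ▸ l.isLt
  rw [typeDGenerator, if_pos hk]
  congr 1
  exact Fin.ext ((Nat.mod_eq_of_lt hn).trans hl.symm)

theorem typeDGenerator_of_pos {k l : Fin n} (hk : l.val + 1 = k.val) :
    typeDGenerator k = signedSwap l k 1 := by
  rw [typeDGenerator, if_neg (by omega)]
  congr 1
  exact Fin.ext (show k.val - 1 = l.val by omega)

/-- The maximal standard parabolic subgroup of `W(D_n)` obtained by leaving out the node `j`. -/
def maximalParabolic (j : Fin n) : Subgroup (Equiv.Perm (Fin n × ℤˣ)) :=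
  Subgroup.closure (typeDGenerator '' {j}ᶜ)

theorem typeDGenerator_mem_maximalParabolic {j k : Fin n} (h : k ≠ j) :
    typeDGenerator k ∈ maximalParabolic j :=
  Subgroup.subset_closure ⟨k, h, rfl⟩

/-- Conjugating adjacent transpositions builds (a, b) without crossing the gap between j - 1 and j,
which is the only bond lost with node j (for j = 0 there is no gap). -/
theorem signedSwap_mem_of_lt {j a b : Fin n} (hab : a < b) (hj : b < j ∨ j ≤ a) :
    signedSwap a b 1 ∈ maximalParabolic j := by
  obtain ⟨d, hd⟩ : ∃ d, a.val + 1 + d = b.val := Nat.exists_eq_add_of_lt hab |>.imp fun _ h => by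
    omega
  induction d generalizing b with
  | zero =>
    rw [← typeDGenerator_of_pos (by simpa using hd)]
    exact typeDGenerator_mem_maximalParabolic (by omega)
  | succ d ih =>
    have hb : b.val - 1 < n := by omega
    have h1 := ih (b := ⟨b.val - 1, hb⟩) (by rw [Fin.lt_def]; simp; omega)
      (by rw [Fin.lt_def]; simp; omega) (by simp; omega)
    have h2 : signedSwap ⟨b.val - 1, hb⟩ b 1 ∈ maximalParabolic j := by
      rw [← typeDGenerator_of_pos (by simp; omega)]
      exact typeDGenerator_mem_maximalParabolic (by omega)
    rw [← signedSwap_conj (b := ⟨b.val - 1, hb⟩) (by rw [Ne, Fin.ext_iff]; simp; omega)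
      (by omega) (by rw [Ne, Fin.ext_iff]; simp; omega)]
    exact mul_mem (mul_mem h2 h1) h2

theorem signedSwap_one_mem {j a b : Fin n} (hab : a ≠ b) (hj : j ≤ a ↔ j ≤ b) :
    signedSwap a b 1 ∈ maximalParabolic j := by
  rcases lt_or_gt_of_ne hab with h | h
  · exact signedSwap_mem_of_lt h (by omega)
  · rw [signedSwap_comm]
    exact signedSwap_mem_of_lt h (by omega)

/-- For j ≥ 2 the generator u remains, and conjugating it by transpositions of {0, …, j-1} gives
every sign-changing swap of that block. -/
theorem signedSwap_neg_one_mem {j a b : Fin n} (h2 : 2 ≤ j.val) (hab : a ≠ b) (ha : a < j)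
    (hb : b < j) : signedSwap a b (-1) ∈ maximalParabolic j := by
  have hn : 2 < n := by omega
  have key : ∀ c : Fin n, c.val ≠ 0 → c < j →
      signedSwap ⟨0, by omega⟩ c (-1) ∈ maximalParabolic j := by
    intro c hc hcj
    have h01 : signedSwap (⟨0, by omega⟩ : Fin n) ⟨1, by omega⟩ (-1) ∈ maximalParabolic j := by
      rw [← typeDGenerator_zero rfl rfl]
      exact typeDGenerator_mem_maximalParabolic (by rw [Ne, Fin.ext_iff]; simp; omega)
    by_cases hc1 : c.val = 1
    · rwa [show c = ⟨1, by omega⟩ from Fin.ext hc1]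
    · have h1c : signedSwap (⟨1, by omega⟩ : Fin n) c 1 ∈ maximalParabolic j :=
        signedSwap_one_mem (by rw [Ne, Fin.ext_iff]; simp; omega)
          (by rw [Fin.le_def, Fin.le_def]; simp; omega)
      rw [← signedSwap_conj (a := (⟨0, by omega⟩ : Fin n)) (b := ⟨1, by omega⟩) (c := c)
        (by simp) (by rw [Ne, Fin.ext_iff]; simp; omega) (by rw [Ne, Fin.ext_iff]; simp; omega)]
      exact mul_mem (mul_mem h1c h01) h1c
  by_cases ha0 : a.val = 0
  · rw [show a = ⟨0, by omega⟩ from Fin.ext ha0]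
    exact key b (by omega) hb
  by_cases hb0 : b.val = 0
  · rw [show b = ⟨0, by omega⟩ from Fin.ext hb0, signedSwap_comm]
    exact key a (by omega) ha
  · have h0b : signedSwap (⟨0, by omega⟩ : Fin n) b 1 ∈ maximalParabolic j :=
      signedSwap_one_mem (by rw [Ne, Fin.ext_iff]; simp; omega)
        (by rw [Fin.le_def, Fin.le_def]; simp; omega)
    rw [← signedSwap_conj (a := a) (b := (⟨0, by omega⟩ : Fin n)) (c := b)
        (by rw [Ne, Fin.ext_iff]; simp; omega) hab (by rw [Ne, Fin.ext_iff]; simp; omega),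
        signedSwap_comm a]
    exact mul_mem (mul_mem h0b (key a ha0 ha)) h0b

/-- The stabilizer of `{j, …, n - 1}` in `W(D_n)` is a standard parabolic subgroup. -/
theorem mem_maximalParabolic {j : Fin n} (h2 : 2 ≤ j.val) (σ : signedPermGroup n)
    (heven : signProd n σ = 1) (hstab : ∀ i, j ≤ absPerm σ i ↔ j ≤ i)
    (hsgn : ∀ i, j ≤ i → sgn σ i = 1) : σ.1 ∈ maximalParabolic j := by
  induction hN : (Finset.univ.filter fun i => σ.1 (i, 1) ≠ (i, 1)).card using
    Nat.strong_induction_on generalizing σ with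
  | _ N ih =>
  -- Induction on the number of moved points: it suffices to find ρ in the subgroup such that ρσ
  -- fixes one more point and still fixes the old ones.
  have step : ∀ ρ : signedPermGroup n, ρ.1 ∈ maximalParabolic j → signProd n ρ = 1 →
      (∀ i, j ≤ absPerm ρ i ↔ j ≤ i) → (∀ i, j ≤ i → sgn ρ i = 1) →
      (∃ i, σ.1 (i, 1) ≠ (i, 1) ∧ ρ.1 (σ.1 (i, 1)) = (i, 1)) →
      (∀ i, σ.1 (i, 1) = (i, 1) → ρ.1 (i, 1) = (i, 1)) →
      σ.1 ∈ maximalParabolic j := by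
    rintro ρ hρ hρ1 hρ2 hρ3 ⟨i, hi1, hi2⟩ hfix
    have hlt : (Finset.univ.filter fun i => (ρ * σ).1 (i, 1) ≠ (i, 1)).card < N := by
      rw [← hN]
      apply Finset.card_lt_card
      rw [Finset.ssubset_iff_of_subset]
      · exact ⟨i, by simpa using hi1, fun hmem => (Finset.mem_filter.1 hmem).2 hi2⟩
      · intro k hk
        simp only [Finset.mem_filter, Finset.mem_univ, true_and] at hk ⊢
        intro hk'
        apply hk
        rw [Subgroup.coe_mul, Equiv.Perm.mul_apply, hk', hfix k hk']
    have := ih _ hlt (ρ * σ) (by rw [map_mul, hρ1, heven, one_mul])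
      (fun i => by rw [absPerm_mul, Equiv.Perm.mul_apply, hρ2, hstab])
      (fun i hi => by rw [sgn_mul, hρ3 _ ((hstab i).2 hi), hsgn i hi, one_mul]) rfl
    rwa [Subgroup.coe_mul, Subgroup.mul_mem_cancel_left _ hρ] at this
  by_cases h1 : ∃ i, absPerm σ i ≠ i
  · obtain ⟨i, hi⟩ := h1
    obtain ⟨a, ha⟩ : ∃ a, a = absPerm σ i := ⟨_, rfl⟩
    rw [← ha] at hi
    have hai : j ≤ a ↔ j ≤ i := ha ▸ hstab i
    have hσi : σ.1 (i, 1) = (a, sgn σ i) := by rw [apply_eq, ha, mul_one]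
    refine step (signedTransposition a i (sgn σ i)) ?_ (signProd_signedTransposition hi _)
      ?_ ?_ ⟨i, ?_, ?_⟩ ?_
    · rcases Int.units_eq_one_or (sgn σ i) with h | h
      · rw [h]
        exact signedSwap_one_mem hi hai
      · have hij : i < j := by
          by_contra hij
          rw [hsgn i (not_lt.1 hij)] at h
          exact absurd h (by decide)
        rw [h]
        exact signedSwap_neg_one_mem h2 hi (by omega) hij
    · intro k
      rw [absPerm_signedTransposition, Equiv.swap_apply_def]
      split_ifs with h h
      · rw [h, hai]
      · rw [h, hai]
      · rfl
    · intro k hk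
      rw [sgn_signedTransposition]
      split_ifs with h
      · apply hsgn
        rcases h with rfl | rfl
        · exact hai.1 hk
        · exact hk
      · rfl
    · rw [hσi]
      exact fun h => hi (congrArg Prod.fst h)
    · rw [hσi]
      change signedSwap _ _ _ _ = _
      simp [signedSwap_apply]
    · intro k hk
      change signedSwap _ _ _ _ = _
      have hka : absPerm σ k = k := congrArg Prod.fst hk
      have h3 : k ≠ i := by
        rintro rfl
        exact hi (ha.trans hka)
      have h4 : k ≠ a := by
        rintro rfl
        exact h3 ((absPerm σ).injective (hka.trans ha))
      simp [signedSwap_apply, h3, h4]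
  push Not at h1
  by_cases h3 : ∃ i, sgn σ i ≠ 1
  · obtain ⟨i, hi⟩ := h3
    -- Evenness gives a second negative sign; (i, k)(i, -k) then changes the signs of i and k
    -- together.
    obtain ⟨k, hki, hk⟩ : ∃ k, k ≠ i ∧ sgn σ k ≠ 1 := by
      by_contra! hall
      rw [signProd_eq, Finset.prod_eq_single i (fun k _ hk => hall k hk) (by simp)] at heven
      exact hi heven
    have hlt : ∀ l, sgn σ l ≠ 1 → l < j := fun l hl => by
      by_contra h
      exact hl (hsgn l (not_lt.1 h))
    have hval : ∀ l, (signedTransposition i k 1 * signedTransposition i k (-1)).1 (l, 1) =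
        if l = i ∨ l = k then (l, -1) else (l, 1) := by
      intro l
      change signedSwap _ _ _ (signedSwap _ _ _ _) = _
      rcases eq_or_ne l i with rfl | hl
      · simp [signedSwap_apply, hki]
      · rcases eq_or_ne l k with rfl | hl'
        · simp [signedSwap_apply, hki]
        · simp [signedSwap_apply, hl, hl']
    refine step (signedTransposition i k 1 * signedTransposition i k (-1)) ?_ ?_ ?_ ?_
      ⟨i, ?_, ?_⟩ ?_
    · exact mul_mem (signedSwap_one_mem hki.symm
        (by have := hlt i hi; have := hlt k hk; omega))
        (signedSwap_neg_one_mem h2 hki.symm (hlt i hi) (hlt k hk))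
    · rw [map_mul, signProd_signedTransposition hki.symm, signProd_signedTransposition hki.symm,
        one_mul]
    · intro l
      rw [absPerm_mul, absPerm_signedTransposition, absPerm_signedTransposition]
      simp
    · intro l hl
      rw [sgn, hval, if_neg]
      rintro (rfl | rfl)
      · exact absurd (hlt _ hi) (not_lt.2 hl)
      · exact absurd (hlt _ hk) (not_lt.2 hl)
    · rw [apply_eq, mul_one]
      exact fun h => hi (congrArg Prod.snd h)
    · have hi' : sgn σ i = -1 := (Int.units_eq_one_or _).resolve_left hi
      have hσi : σ.1 (i, 1) = (i, -1) := by rw [apply_eq, h1, hi', mul_one]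
      rw [hσi, apply_eq]
      have e := hval i
      rw [if_pos (Or.inl rfl), apply_eq, mul_one, Prod.mk.injEq] at e
      rw [e.1, e.2]
      simp
    · intro l hl
      rw [hval, if_neg]
      have hl' : sgn σ l = 1 := congrArg Prod.snd hl
      rintro (rfl | rfl)
      · exact hi hl'
      · exact hk hl'
  · push Not at h3
    rw [show σ = 1 from ext_absPerm_sgn h1 h3]
    exact one_mem _

theorem apply_mem_iff_of_mem_maximalParabolic {j : Fin n} {S : Set (Fin n × ℤˣ)}
    (hS : ∀ k ≠ j, ∀ x, typeDGenerator k x ∈ S ↔ x ∈ S) {g : Equiv.Perm (Fin n × ℤˣ)}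
    (hg : g ∈ maximalParabolic j) (x : Fin n × ℤˣ) : g x ∈ S ↔ x ∈ S := by
  have : ∀ x, g x ∈ S ↔ x ∈ S := by
    refine Subgroup.closure_induction (p := fun g _ => ∀ x, g x ∈ S ↔ x ∈ S) ?_ (by simp) ?_ ?_ hg
    · rintro _ ⟨k, hk, rfl⟩
      exact hS k hk
    · intro a b _ _ ha hb x
      rw [Equiv.Perm.mul_apply, ha, hb]
    · intro a _ ha x
      rw [← ha]
      simp
  exact this x

/-- Every generator other than s_j permutes the positive points of {j, …, n-1}. This invariant
yields both the stability of the block and the signs + on it. -/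
theorem apply_mem_iff {j : Fin n} (h2 : 2 ≤ j.val) {g : Equiv.Perm (Fin n × ℤˣ)}
    (hg : g ∈ maximalParabolic j) (x : Fin n × ℤˣ) :
    (j ≤ (g x).1 ∧ (g x).2 = 1) ↔ (j ≤ x.1 ∧ x.2 = 1) := by
  refine apply_mem_iff_of_mem_maximalParabolic (S := {x | j ≤ x.1 ∧ x.2 = 1}) ?_ hg x
  rintro k hk ⟨i, ε⟩
  have hkn := k.isLt
  simp only [Set.mem_ofPred_eq]
  by_cases hk0 : k.val = 0
  · rw [typeDGenerator_zero (l := ⟨1, by omega⟩) hk0 rfl, signedSwap_apply]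
    have hk' : ¬ j ≤ k := by omega
    have h1 : ¬ j ≤ (⟨1, by omega⟩ : Fin n) := by rw [Fin.le_def]; simp; omega
    split_ifs with h h'
    · have : i = k := h
      simp [this, hk', h1]
    · have : i = ⟨1, by omega⟩ := h'
      simp [this, hk', h1]
    · rfl
  · rw [typeDGenerator_of_pos (l := ⟨k.val - 1, by omega⟩) (by simp; omega), signedSwap_apply]
    have h1 : j ≤ (⟨k.val - 1, by omega⟩ : Fin n) ↔ j ≤ k := by
      rw [Fin.le_def, Fin.le_def]; simp; omega
    split_ifs with h h'
    · have : i = ⟨k.val - 1, by omega⟩ := h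
      simp [this, h1]
    · have : i = k := h'
      simp [this, h1]
    · rfl

theorem le_absPerm_iff {j : Fin n} (h2 : 2 ≤ j.val) {σ : signedPermGroup n}
    (hσ : σ.1 ∈ maximalParabolic j) (i : Fin n) : j ≤ absPerm σ i ↔ j ≤ i := by
  have key := apply_mem_iff h2 hσ
  refine ⟨fun hi => ?_, fun hi => ((key (i, 1)).2 ⟨hi, rfl⟩).1⟩
  have := (key (σ.1⁻¹ (absPerm σ i, 1))).1 (by simpa using hi)
  have e : σ.1⁻¹ (absPerm σ i, 1) = (i, sgn σ i) := by
    rw [Equiv.Perm.inv_eq_iff_eq, apply_eq, Int.units_mul_self]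
  rw [e] at this
  exact this.1

theorem sgn_eq_one_of_mem_maximalParabolic {j : Fin n} (h2 : 2 ≤ j.val) {σ : signedPermGroup n}
    (hσ : σ.1 ∈ maximalParabolic j) {i : Fin n} (hi : j ≤ i) : sgn σ i = 1 :=
  ((apply_mem_iff h2 hσ (i, 1)).2 ⟨hi, rfl⟩).2

/-- Elements of the two maximal parabolic subgroups of type `A_{n-1}` have no negative cycles. -/
theorem not_inNegativeCycle_of_mem {j : Fin n} (hn : 1 < n) (h2 : j.val < 2)
    {σ : signedPermGroup n} (hσ : σ.1 ∈ maximalParabolic j) (i : Fin n) :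
    ¬ InNegativeCycle σ i := by
  -- The subgroup preserves a set with exactly one of each pair ±i: all positive points if u is
  -- omitted, the same with the first point negated if s_1 is omitted. A negative cycle would meet
  -- both this set and its negative.
  let s : Fin n → ℤˣ := fun i => if j.val = 1 ∧ i.val = 0 then -1 else 1
  have key : ∀ x, σ.1 x ∈ {x : Fin n × ℤˣ | x.2 = s x.1} ↔ x ∈ {x : Fin n × ℤˣ | x.2 = s x.1} := by
    refine apply_mem_iff_of_mem_maximalParabolic ?_ hσ
    rintro k hk ⟨i, ε⟩
    have hkn := k.isLt
    simp only [Set.mem_ofPred_eq, s]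
    by_cases hk0 : k.val = 0
    · have hj : j.val = 1 := by omega
      rw [typeDGenerator_zero (l := ⟨1, by omega⟩) hk0 rfl, signedSwap_apply]
      split_ifs with h h' <;> simp_all [neg_eq_iff_eq_neg]
    · rw [typeDGenerator_of_pos (l := ⟨k.val - 1, by omega⟩) (by simp; omega), signedSwap_apply]
      have e : j.val = 1 → k.val - 1 ≠ 0 := by omega
      rcases eq_or_ne i ⟨k.val - 1, by omega⟩ with rfl | h
      · by_cases hj1 : j.val = 1 <;> simp_all
      · rcases eq_or_ne i k with rfl | h'
        · by_cases hj1 : j.val = 1 <;> simp_all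
        · simp [h, h']
  intro hneg
  have h1 : ∀ x, (σ.1 x).2 = s (σ.1 x).1 ↔ x.2 = s x.1 := key
  have h3 := eq_of_sameCycle (f := fun x : Fin n × ℤˣ => x.2 = s x.1)
    (fun x => propext (h1 x)) hneg
  simp only [eq_iff_iff] at h3
  rcases Int.units_eq_one_or (s i) with h | h <;> rw [h] at h3 <;> exact absurd h3 (by decide)

/-- The maximal parabolic subgroups containing a non-compliant element whose positive cycle is
`{j, …, n - 1}`. -/
theorem IsNonCompliant.eq_of_mem_maximalParabolic {σ : signedPermGroup n} (h : IsNonCompliant σ)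
    (hn : 1 < n) {j k : Fin n} (hj : ∀ i, InNegativeCycle σ i ↔ i < j)
    (hk : σ.1 ∈ maximalParabolic k) : k = j := by
  classical
  rcases lt_or_ge k.val 2 with h2 | h2
  · obtain ⟨i, hi⟩ := h.exists_inNegativeCycle
    exact absurd hi (not_inNegativeCycle_of_mem hn h2 hk i)
  have key := apply_mem_iff h2 hk
  have hjk : j ≤ k := by
    -- The positive points of {k, …, n-1} form an invariant set, so no negative cycle passes through
    -- k.
    rw [← not_lt, ← hj]
    intro hneg
    have h3 := eq_of_sameCycle (f := fun x : Fin n × ℤˣ => k ≤ x.1 ∧ x.2 = 1)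
      (fun x => propext (key x)) hneg
    have h4 : (-1 : ℤˣ) ≠ 1 := by decide
    simp [h4] at h3
  by_contra hne
  -- If j < k, this invariant function would separate the positive points j and k.
  let f : Fin n → ℤˣ := fun i => if k ≤ i then -1 else 1
  have hf : ∀ i, f (absPerm σ i) = f i := fun i => by simp [f, le_absPerm_iff h2 hk]
  have h1 := (h.prod_eq f hf k (by rw [hj]; omega)).symm.trans
    (h.prod_eq f hf j (by rw [hj]; omega))
  have hkj : ¬ k ≤ j := by omega
  simp [f, hkj] at h1

/-- Up to conjugation by `W(D_n)`, the positive cycle of a non-compliant signed permutation is a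
cyclic permutation of `{j, …, n - 1}`. -/
theorem IsNonCompliant.exists_conj {σ : signedPermGroup n} (h : IsNonCompliant σ) (hodd : Odd n) :
    ∃ (x : signedPermGroup n) (j : Fin n), signProd n x = 1 ∧ 2 ≤ j.val ∧
      (∀ i, InNegativeCycle (x * σ * x⁻¹) i ↔ i < j) ∧
      ∀ i, j ≤ i → sgn (x * σ * x⁻¹) i = 1 := by
  classical
  obtain ⟨a, ha⟩ := h.exists_not_inNegativeCycle
  obtain ⟨b, hb⟩ := h.exists_inNegativeCycle
  obtain ⟨m, hm⟩ : ∃ m, m = (Finset.univ.filter fun i => ¬ InNegativeCycle σ i).card := ⟨_, rfl⟩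
  have hmodd : Odd m := hm ▸ h.odd_card
  have hmn : m < n := by
    have : m < (Finset.univ : Finset (Fin n)).card := by
      rw [hm]
      apply Finset.card_lt_card
      rw [Finset.ssubset_iff_of_subset (Finset.filter_subset _ _)]
      exact ⟨b, Finset.mem_univ _, by simpa using hb⟩
    simpa using this
  have hm0 := hmodd.pos
  obtain ⟨j, hj⟩ : ∃ j : Fin n, j.val = n - m := ⟨⟨n - m, by omega⟩, rfl⟩
  have hcard : Fintype.card {i // ¬ InNegativeCycle σ i} = Fintype.card {i : Fin n // j ≤ i} := by
    rw [Fintype.card_subtype, Fintype.card_subtype, ← hm, Finset.filter_le_eq_Ici, Fin.card_Ici]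
    omega
  let e := Fintype.equivOfCardEq hcard
  have he : ∀ i, j ≤ e.extendSubtype i ↔ ¬ InNegativeCycle σ i := fun i =>
    ⟨fun hi => by_contra fun hi' => e.extendSubtype_not_mem i hi' hi, e.extendSubtype_mem i⟩
  -- Choose the sign of each positive point so that it lies on the cycle of (a, 1); after
  -- conjugation all signs of the positive cycle are +.
  let s₀ : Fin n → ℤˣ := fun i =>
    if InNegativeCycle σ i then 1 else if σ.1.SameCycle (a, 1) (i, 1) then 1 else -1
  -- The sign at b, on a negative cycle, is free and is used to make the conjugating element even.
  let s : Fin n → ℤˣ := s₀ * Pi.mulSingle b (∏ i, s₀ i)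
  have hs : ∀ i, ¬ InNegativeCycle σ i → s i = s₀ i := by
    intro i hi
    have : i ≠ b := by rintro rfl; exact hi hb
    simp [s, this]
  have hs' : ∀ i ε, ¬ InNegativeCycle σ i → (σ.1.SameCycle (a, 1) (i, ε) ↔ ε = s i) := by
    intro i ε hi
    rw [hs i hi]
    simp only [s₀, if_neg hi]
    have h1 : σ.1.SameCycle (a, 1) (i, 1) ∨ σ.1.SameCycle (a, 1) (i, -1) := by
      obtain ⟨k, hk⟩ := (h.sameCycle ha hi).exists_nat_pow_eq
      have h2 := pow_apply_eq σ a k 1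
      rw [hk] at h2
      have h3 : σ.1.SameCycle (a, 1) ((σ.1 ^ k) (a, 1)) := ⟨k, by simp⟩
      rw [h2] at h3
      rcases Int.units_eq_one_or ((∏ r ∈ Finset.range k, sgn σ ((absPerm σ ^ r) a)) * 1)
        with h4 | h4 <;> rw [h4] at h3
      · exact Or.inl h3
      · exact Or.inr h3
    have h2 : ¬ (σ.1.SameCycle (a, 1) (i, 1) ∧ σ.1.SameCycle (a, 1) (i, -1)) :=
      fun h => hi (h.1.symm.trans h.2)
    have h4 : (1 : ℤˣ) ≠ -1 := by decide
    rcases Int.units_eq_one_or ε with rfl | rfl <;> split_ifs with h5 <;>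
      simp_all [Ne.symm]
  have hneg : ∀ i, InNegativeCycle (ofPermSigns e.extendSubtype s * σ *
      (ofPermSigns e.extendSubtype s)⁻¹) i ↔ i < j := by
    intro i
    obtain ⟨i, rfl⟩ := e.extendSubtype.surjective i
    rw [← not_le, he, not_not]
    exact inNegativeCycle_conj_iff (ofPermSigns e.extendSubtype s) σ i
  refine ⟨ofPermSigns e.extendSubtype s, j, ?_, ?_, hneg, ?_⟩
  · simp only [signProd_eq, sgn_ofPermSigns, s, Pi.mul_apply]
    rw [Finset.prod_mul_distrib, Fintype.prod_pi_mulSingle', Int.units_mul_self]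
  -- With n and m odd and m < n, the number j = n - m is even and positive.
  · obtain ⟨r, hr⟩ := hodd
    obtain ⟨r', hr'⟩ := hmodd
    omega
  · intro i hi
    obtain ⟨i, rfl⟩ := e.extendSubtype.surjective i
    rw [he] at hi
    have hi' : ¬ InNegativeCycle σ (absPerm σ i) := by rwa [inNegativeCycle_apply]
    have h1 : sgn σ i * s i = s (absPerm σ i) := by
      rw [← hs' _ _ hi', ← apply_eq]
      rw [Equiv.Perm.sameCycle_apply_right, hs' _ _ hi]
    obtain ⟨ρ, hρ⟩ : ∃ ρ, ρ = ofPermSigns e.extendSubtype s * σ *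
      (ofPermSigns e.extendSubtype s)⁻¹ := ⟨_, rfl⟩
    have h2 := congrArg (fun ρ => sgn ρ i) (eq_mul_inv_iff_mul_eq.1 hρ)
    simp only [sgn_mul, absPerm_ofPermSigns, sgn_ofPermSigns] at h2
    rw [← hρ]
    rw [← h1, mul_comm (sgn σ i), mul_assoc, Int.units_mul_self, mul_one] at h2
    exact mul_eq_right.1 h2

end SignedPerm

/-! ### Complements and elements of order at most two -/

/-- For the factor m of g in the complement, m² is congruent to g² modulo V, hence lies in both V
and the complement. -/
theorem exists_mul_self_eq_one_of_hasComplementIn {G : Type*} [Group G] {V C : Subgroup G}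
    (h : HasComplementIn (V ⊓ C) C) {g : G} (hg : g ∈ C) (hnorm : ∀ v ∈ V, g * v * g⁻¹ ∈ V)
    (hsq : g * g ∈ V) : ∃ v ∈ V, ∃ m ∈ C, m * m = 1 ∧ g = v * m := by
  obtain ⟨N, hN⟩ := h
  obtain ⟨⟨⟨v, hv⟩, ⟨m, hm⟩⟩, hvm⟩ := hN.2 ⟨g, hg⟩
  have hvV : (v : G) ∈ V := (Subgroup.mem_subgroupOf.1 hv).1
  have hvm' : (v : G) * m = g := congrArg Subtype.val hvm
  refine ⟨v, hvV, m, m.2, ?_, hvm'.symm⟩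
  have h1 : (m * m : G) = (v : G)⁻¹ * (g * (v : G)⁻¹ * g⁻¹) * (g * g) := by
    rw [← hvm']; group
  have h2 : m * m ∈ (V ⊓ C).subgroupOf C ⊓ N := by
    refine ⟨Subgroup.mem_subgroupOf.2 ⟨?_, (m * m).2⟩, mul_mem hm hm⟩
    rw [Subgroup.coe_mul, h1]
    exact V.mul_mem (V.mul_mem (V.inv_mem hvV) (hnorm _ (V.inv_mem hvV))) hsq
  rw [hN.disjoint.eq_bot, Subgroup.mem_bot] at h2
  exact congrArg Subtype.val h2

namespace CoxeterSystem

open SignedPerm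

variable {B W : Type*} [Group W] {M : CoxeterMatrix B} (cs : CoxeterSystem M W)

/-! ### Non-compliant elements in Coxeter groups -/

theorem commute_of_mem_standardParabolic {K L : Set B} (h : ∀ i ∈ K, ∀ j ∈ L, M i j = 2)
    {a b : W} (ha : a ∈ cs.standardParabolic K) (hb : b ∈ cs.standardParabolic L) :
    a * b = b * a := by
  have hle : cs.standardParabolic K ≤ Subgroup.centralizer (cs.standardParabolic L : Set W) := by
    rw [standardParabolic, standardParabolic, Subgroup.centralizer_closure, Subgroup.closure_le]
    rintro _ ⟨i, hi, rfl⟩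
    rw [SetLike.mem_coe, Subgroup.mem_centralizer_iff]
    rintro _ ⟨j, hj, rfl⟩
    have h1 := cs.simple_mul_simple_pow i j
    rw [h i hi j hj, pow_two] at h1
    rw [eq_comm, mul_eq_one_iff_eq_inv.1 h1]
    simp
  exact (Subgroup.mem_centralizer_iff.1 (hle ha) b hb).symm

theorem exists_mul_of_mem_standardParabolic_union {K L : Set B} (h : ∀ i ∈ K, ∀ j ∈ L, M i j = 2)
    {x : W} (hx : x ∈ cs.standardParabolic (K ∪ L)) :
    ∃ a ∈ cs.standardParabolic K, ∃ b ∈ cs.standardParabolic L, x = a * b := by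
  refine Subgroup.closure_induction (p := fun x _ => ∃ a ∈ cs.standardParabolic K,
    ∃ b ∈ cs.standardParabolic L, x = a * b) ?_ ⟨1, one_mem _, 1, one_mem _, by simp⟩ ?_ ?_ hx
  · rintro _ ⟨i, hi | hi, rfl⟩
    · exact ⟨_, cs.simple_mem_standardParabolic hi, 1, one_mem _, by simp⟩
    · exact ⟨1, one_mem _, _, cs.simple_mem_standardParabolic hi, by simp⟩
  · rintro _ _ _ _ ⟨a, ha, b, hb, rfl⟩ ⟨a', ha', b', hb', rfl⟩
    refine ⟨a * a', mul_mem ha ha', b * b', mul_mem hb hb', ?_⟩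
    rw [mul_assoc, ← mul_assoc b, ← cs.commute_of_mem_standardParabolic h ha' hb]
    simp only [mul_assoc]
  · rintro _ _ ⟨a, ha, b, hb, rfl⟩
    refine ⟨a⁻¹, inv_mem ha, b⁻¹, inv_mem hb, ?_⟩
    rw [mul_inv_rev, cs.commute_of_mem_standardParabolic h (inv_mem ha) (inv_mem hb)]

section TypeD

variable {n : ℕ} {e : Fin n ↪ B}
  (φ : cs.standardParabolic (Set.range e) ≃* evenSignedPermGroup n)

/-- The embedding of `W_K` into the group of signed permutations given by an identification of
`W_K` with `W(D_n)`. -/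
def toSignedPerm : cs.standardParabolic (Set.range e) →* signedPermGroup n :=
  (evenSignedPermGroup n).subtype.comp φ.toMonoidHom

theorem toSignedPerm_injective : Function.Injective (cs.toSignedPerm φ) :=
  Subtype.val_injective.comp φ.injective

theorem signProd_toSignedPerm (x : cs.standardParabolic (Set.range e)) :
    signProd n (cs.toSignedPerm φ x) = 1 :=
  (φ x).2

theorem exists_toSignedPerm_eq {σ : signedPermGroup n} (hσ : signProd n σ = 1) :
    ∃ x, cs.toSignedPerm φ x = σ :=
  ⟨φ.symm ⟨σ, hσ⟩, congrArg Subtype.val (φ.apply_symm_apply ⟨σ, hσ⟩)⟩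

variable {φ}

/-- Both subgroups are images of one subgroup of W_K under injective homomorphisms matching the
generators. -/
theorem IsTypeDIdentification.mem_iff (hφ : cs.IsTypeDIdentification e φ) (j : Fin n)
    (x : cs.standardParabolic (Set.range e)) :
    (x : W) ∈ cs.standardParabolic (e '' {j}ᶜ) ↔
      (cs.toSignedPerm φ x).1 ∈ maximalParabolic j := by
  let s : Fin n → cs.standardParabolic (Set.range e) :=
    fun k => ⟨cs.simple (e k), cs.simple_mem_standardParabolic ⟨k, rfl⟩⟩
  let T := Subgroup.closure (s '' {j}ᶜ)
  have h1 : cs.standardParabolic (e '' {j}ᶜ) = T.map (Subgroup.subtype _) := by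
    rw [MonoidHom.map_closure, standardParabolic, Set.image_image, Set.image_image]
    rfl
  have h2 : maximalParabolic j =
      T.map ((signedPermGroup n).subtype.comp (cs.toSignedPerm φ)) := by
    rw [MonoidHom.map_closure, maximalParabolic, Set.image_image]
    congr 1
    exact Set.image_congr fun k _ => (hφ k).symm
  have h3 : (x : W) ∈ T.map (Subgroup.subtype _) ↔ x ∈ T :=
    Subgroup.mem_map_iff_mem (f := Subgroup.subtype _) Subtype.val_injective
  have h4 : (cs.toSignedPerm φ x).1 ∈
      T.map ((signedPermGroup n).subtype.comp (cs.toSignedPerm φ)) ↔ x ∈ T :=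
    Subgroup.mem_map_iff_mem (f := (signedPermGroup n).subtype.comp (cs.toSignedPerm φ))
      (Subtype.val_injective.comp (cs.toSignedPerm_injective φ))
  rw [h1, h2, h3, h4]

variable {L : Set B}

/-- The quotient a'⁻¹a lies in W_K and W_L, so it is central in W_K, whose centre is trivial. -/
theorem eq_and_eq_of_mul_eq_mul (hodd : Odd n) (hn : 2 < n)
    (φ : cs.standardParabolic (Set.range e) ≃* evenSignedPermGroup n)
    (hL : ∀ i ∈ Set.range e, ∀ j ∈ L, M i j = 2)
    {a a' b b' : W} (ha : a ∈ cs.standardParabolic (Set.range e))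
    (ha' : a' ∈ cs.standardParabolic (Set.range e)) (hb : b ∈ cs.standardParabolic L)
    (hb' : b' ∈ cs.standardParabolic L) (h : a * b = a' * b') : a = a' ∧ b = b' := by
  have h1 : a'⁻¹ * a = b' * b⁻¹ := by
    rw [eq_mul_inv_iff_mul_eq, mul_assoc, h, inv_mul_cancel_left]
  have hmem : a'⁻¹ * a ∈ cs.standardParabolic (Set.range e) := mul_mem (inv_mem ha') ha
  have hmem' : a'⁻¹ * a ∈ cs.standardParabolic L := h1 ▸ mul_mem hb' (inv_mem hb)
  have h2 : cs.toSignedPerm φ ⟨_, hmem⟩ = 1 := by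
    refine eq_one_of_commute_signedTransposition hodd hn (cs.signProd_toSignedPerm φ _) ?_
    intro i k hik
    obtain ⟨x, hx⟩ := cs.exists_toSignedPerm_eq φ (signProd_signedTransposition hik 1)
    rw [← hx, ← map_mul, ← map_mul]
    congr 1
    exact Subtype.ext (cs.commute_of_mem_standardParabolic hL x.2 hmem').symm
  have h3 := cs.toSignedPerm_injective φ (h2.trans (map_one _).symm)
  have h4 : a'⁻¹ * a = 1 := congrArg Subtype.val h3
  obtain rfl : a' = a := inv_mul_eq_one.1 h4
  exact ⟨rfl, mul_left_cancel h⟩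

/-- If the positive cycle of `p` is `{j, …, n - 1}`, then all nodes of type `D_n` other than `j`
occur in a reduced expression of `p * q`. -/
theorem image_compl_subset_generatorSupport (hodd : Odd n) (hn : 2 < n)
    (hL : ∀ i ∈ Set.range e, ∀ j ∈ L, M i j = 2) (hφ : cs.IsTypeDIdentification e φ) {j : Fin n}
    {p : cs.standardParabolic (Set.range e)} {q : W} (hq : q ∈ cs.standardParabolic L)
    (hp : IsNonCompliant (cs.toSignedPerm φ p))
    (hj : ∀ i, InNegativeCycle (cs.toSignedPerm φ p) i ↔ i < j) :
    e '' {j}ᶜ ⊆ cs.generatorSupport (p * q) := by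
  rintro _ ⟨k, hk, rfl⟩
  by_contra hnot
  have hpq : p * q ∈ cs.standardParabolic (Set.range e ∪ L) :=
    mul_mem (cs.standardParabolic_mono Set.subset_union_left p.2)
      (cs.standardParabolic_mono Set.subset_union_right hq)
  obtain ⟨ω, hω, hpω, hmem⟩ := cs.exists_isReduced_of_mem_standardParabolic hpq
  -- If node k is missing, p lies in the maximal parabolic subgroup omitting k, which forces k = j.
  have hsub : ∀ i ∈ ω, i ∈ e '' {k}ᶜ ∪ L := by
    intro i hi
    refine (hmem i hi).imp_left ?_
    rintro ⟨l, rfl⟩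
    refine ⟨l, ?_, rfl⟩
    rintro rfl
    exact hnot ⟨ω, hω, hpω.symm, hi⟩
  have hw : p * q ∈ cs.standardParabolic (e '' {k}ᶜ ∪ L) := by
    rw [hpω]
    exact cs.wordProd_mem_of_forall fun i hi => cs.simple_mem_standardParabolic (hsub i hi)
  obtain ⟨a, ha, b, hb, hab⟩ := cs.exists_mul_of_mem_standardParabolic_union
    (fun i hi => hL i (Set.image_subset_range _ _ hi)) hw
  obtain ⟨rfl, -⟩ := cs.eq_and_eq_of_mul_eq_mul hodd hn φ hL p.2
    (cs.standardParabolic_mono (Set.image_subset_range _ _) ha) hq hb hab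
  exact hk (hp.eq_of_mem_maximalParabolic (by omega) hj ((hφ.mem_iff cs k p).1 ha))

/-- Every element with a non-compliant class is conjugate to a product `p * q`, of minimal length
among its conjugates under the parabolic subgroup generated by `K ∖ {j}` and `L`, such that the
positive cycle of `p` is a cyclic permutation of `{j, …, n - 1}`. -/
theorem exists_conj_mul (hodd : Odd n)
    (hL : ∀ i ∈ Set.range e, ∀ j ∈ L, M i j = 2) (hφ : cs.IsTypeDIdentification e φ)
    {p : cs.standardParabolic (Set.range e)} {q : W} (hq : q ∈ cs.standardParabolic L)
    (hp : IsNonCompliant (cs.toSignedPerm φ p)) :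
    ∃ (j : Fin n) (p' : cs.standardParabolic (Set.range e)) (q' z : W),
      2 ≤ j.val ∧ q' ∈ cs.standardParabolic L ∧ p * q = z * (p' * q') * z⁻¹ ∧
      IsNonCompliant (cs.toSignedPerm φ p') ∧
      (∀ i, InNegativeCycle (cs.toSignedPerm φ p') i ↔ i < j) ∧
      (cs.toSignedPerm φ p').1 ∈ maximalParabolic j ∧
      ∀ x ∈ cs.standardParabolic (e '' {j}ᶜ ∪ L),
        cs.length (p' * q') ≤ cs.length (x * (p' * q') * x⁻¹) := by
  obtain ⟨x, j, hx, h2, hneg, hsgn⟩ := hp.exists_conj hodd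
  obtain ⟨X, rfl⟩ := cs.exists_toSignedPerm_eq φ hx
  rw [← map_mul, ← map_inv, ← map_mul] at hneg hsgn
  obtain ⟨p₀, hp₀⟩ : ∃ p₀, p₀ = X * p * X⁻¹ := ⟨_, rfl⟩
  rw [← hp₀] at hneg hsgn
  have hp₀j : (cs.toSignedPerm φ p₀).1 ∈ maximalParabolic j := by
    refine mem_maximalParabolic h2 _ (cs.signProd_toSignedPerm φ _) (fun i => ?_) hsgn
    rw [← not_lt, ← hneg, inNegativeCycle_apply, hneg, not_lt]
  obtain ⟨⟨y, hy⟩, hmin⟩ : ∃ y : cs.standardParabolic (e '' {j}ᶜ ∪ L),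
      ∀ y' : cs.standardParabolic (e '' {j}ᶜ ∪ L),
        cs.length (y * (p₀ * q) * (y : W)⁻¹) ≤ cs.length (y' * (p₀ * q) * (y' : W)⁻¹) :=
    ⟨_, fun y' => Function.argmin_le (fun y : cs.standardParabolic (e '' {j}ᶜ ∪ L) =>
      cs.length (y * (p₀ * q) * (y : W)⁻¹)) y'⟩
  obtain ⟨a, ha, b, hb, rfl⟩ := cs.exists_mul_of_mem_standardParabolic_union
    (fun i hi => hL i (Set.image_subset_range _ _ hi)) hy
  have haK := cs.standardParabolic_mono (Set.image_subset_range e _) ha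
  obtain ⟨A, rfl⟩ : ∃ A : cs.standardParabolic (Set.range e), A.1 = a := ⟨⟨a, haK⟩, rfl⟩
  have hAj := (hφ.mem_iff cs j A).1 ha
  have hcomm : ∀ (c : cs.standardParabolic (Set.range e)), c * b = b * c :=
    fun c => cs.commute_of_mem_standardParabolic hL c.2 hb
  -- The minimising conjugator splits as Ab with A ∈ W_{K∖{j}}, so it preserves the block {j, …,
  -- n-1} and the product form.
  have hprod : (A * b) * (p₀ * q) * (A * b)⁻¹ =
      ((A * p₀ * A⁻¹ : cs.standardParabolic (Set.range e)) : W) * (b * q * b⁻¹) := by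
    have h1 := hcomm p₀
    have h3 := cs.commute_of_mem_standardParabolic hL (A⁻¹).2 (mul_mem (mul_mem hb hq) (inv_mem hb))
    simp only [Subgroup.coe_mul, Subgroup.coe_inv] at h3 ⊢
    calc (A * b) * (p₀ * q) * (A * b : W)⁻¹ = A * (b * p₀) * q * b⁻¹ * (A : W)⁻¹ := by group
      _ = A * p₀ * ((b * q * b⁻¹) * (A : W)⁻¹) := by rw [← h1]; group
      _ = _ := by rw [← h3]; group
  refine ⟨j, A * p₀ * A⁻¹, b * q * b⁻¹, (X : W)⁻¹ * (A * b)⁻¹, h2,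
    mul_mem (mul_mem hb hq) (inv_mem hb), ?_, ?_, ?_, ?_, ?_⟩
  · rw [← hprod]
    have h3 : (p₀ : W) * q = X * (p * q) * (X : W)⁻¹ := by
      rw [hp₀, Subgroup.coe_mul, Subgroup.coe_mul, Subgroup.coe_inv, mul_assoc,
        cs.commute_of_mem_standardParabolic hL (inv_mem X.2) hq]
      group
    rw [h3]
    group
  · rw [map_mul, map_mul, map_inv, hp₀, map_mul, map_mul, map_inv]
    exact (hp.conj _).conj _
  · intro i
    obtain ⟨i, rfl⟩ := (absPerm (cs.toSignedPerm φ A)).surjective i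
    rw [map_mul, map_mul, map_inv, inNegativeCycle_conj_iff, hneg, ← not_le, ← not_le,
      le_absPerm_iff h2 hAj]
  · rw [← hφ.mem_iff cs, Subgroup.coe_mul, Subgroup.coe_mul, Subgroup.coe_inv]
    exact mul_mem (mul_mem ha ((hφ.mem_iff cs j p₀).2 hp₀j)) (inv_mem ha)
  · intro x hx
    rw [← hprod]
    have := hmin (⟨x, hx⟩ * ⟨A * b, hy⟩)
    refine this.trans_eq (congrArg cs.length ?_)
    simp only [Subgroup.coe_mul]
    group

theorem not_hasComplementIn_parabolicClosure (hodd : Odd n) (hn : 2 < n)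
    (hL : ∀ i ∈ Set.range e, ∀ j ∈ L, M i j = 2) (hφ : cs.IsTypeDIdentification e φ) {j : Fin n}
    (h2 : 2 ≤ j.val) {p : cs.standardParabolic (Set.range e)} {q z w : W}
    (hq : q ∈ cs.standardParabolic L) (hw : w = z * (p * q) * z⁻¹)
    (hp : IsNonCompliant (cs.toSignedPerm φ p))
    (hj : ∀ i, InNegativeCycle (cs.toSignedPerm φ p) i ↔ i < j)
    (hpj : (cs.toSignedPerm φ p).1 ∈ maximalParabolic j)
    (hmin : ∀ x ∈ cs.standardParabolic (e '' {j}ᶜ ∪ L),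
        cs.length (p * q) ≤ cs.length (x * (p * q) * x⁻¹)) :
    ¬ HasComplementIn (cs.parabolicClosure w ⊓ Subgroup.centralizer {w})
        (Subgroup.centralizer {w}) := by
  intro hcompl
  have hpq : p * q ∈ cs.standardParabolic (e '' {j}ᶜ ∪ L) :=
    mul_mem (cs.standardParabolic_mono Set.subset_union_left ((hφ.mem_iff cs j p).2 hpj))
      (cs.standardParabolic_mono Set.subset_union_right hq)
  have hclosure := cs.parabolicClosure_eq_of_forall_length_le hpq hmin
  have hle : cs.parabolicClosure (p * q) ≤ cs.standardParabolic (e '' {j}ᶜ ∪ L) :=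
    sInf_le ⟨cs.isParabolic_standardParabolic _, hpq⟩
  obtain ⟨g, hg1, hg2, hg3⟩ := hp.exists_commute_neg
  obtain ⟨G, rfl⟩ := cs.exists_toSignedPerm_eq φ hg1
  have hGp : (G : W) * p = p * G := by
    rw [← map_mul, ← map_mul] at hg2
    exact congrArg Subtype.val (cs.toSignedPerm_injective φ hg2)
  have hGL : ∀ b ∈ cs.standardParabolic L, (G : W) * b = b * G :=
    fun b hb => cs.commute_of_mem_standardParabolic hL G.2 hb
  have hGw : (G : W) * (p * q) = p * q * G := by
    rw [← mul_assoc, hGp, mul_assoc, hGL q hq, mul_assoc]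
  -- G² preserves the positive cycle with signs (-1)² = 1, so it lies in W_{K∖{j}}, which the
  -- support of pq generates within the closure.
  have hGG : (G : W) * G ∈ cs.parabolicClosure (p * q) := by
    rw [hclosure]
    refine cs.standardParabolic_mono
      (cs.image_compl_subset_generatorSupport hodd hn hL hφ hq hp hj) ?_
    rw [← Subgroup.coe_mul, hφ.mem_iff cs, map_mul]
    refine mem_maximalParabolic h2 _ (by rw [map_mul, hg1, one_mul]) (fun i => ?_) fun i hi => ?_
    · rw [← not_lt, ← hj, absPerm_mul, Equiv.Perm.mul_apply, inNegativeCycle_apply_of_commute hg2,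
        inNegativeCycle_apply_of_commute hg2, hj, not_lt]
    · obtain ⟨h3, h4⟩ := hg3 i (by rw [hj]; exact not_lt.2 hi)
      rw [sgn_mul, h3, h4, Int.units_mul_self]
  have hgw : z * G * z⁻¹ ∈ Subgroup.centralizer {w} := by
    rw [Subgroup.mem_centralizer_singleton_iff, hw]
    calc z * G * z⁻¹ * (z * (p * q) * z⁻¹) = z * (G * (p * q)) * z⁻¹ := by group
      _ = _ := by rw [hGw]; group
  obtain ⟨v, hv, m, hm, hmm, hvm⟩ := exists_mul_self_eq_one_of_hasComplementIn hcompl hgw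
    (fun v hv => by
      have := cs.conj_mem_parabolicClosure (z * G * z⁻¹) hv
      rwa [Subgroup.mem_centralizer_singleton_iff.1 hgw, mul_inv_cancel_right] at this)
    (by
      have := cs.conj_mem_parabolicClosure z hGG
      rw [← hw] at this
      rwa [show z * G * z⁻¹ * (z * G * z⁻¹) = z * (G * G) * z⁻¹ by group])
  rw [Subgroup.mem_centralizer_singleton_iff] at hm
  have hv' : z⁻¹ * v * z ∈ cs.parabolicClosure (p * q) := by
    have := cs.conj_mem_parabolicClosure z⁻¹ hv
    rw [hw] at this
    simpa [mul_assoc] using this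
  obtain ⟨a, ha, b, hb, hab⟩ := cs.exists_mul_of_mem_standardParabolic_union
    (fun i hi => hL i (Set.image_subset_range _ _ hi)) (hle hv')
  have haK := cs.standardParabolic_mono (Set.image_subset_range e _) ha
  obtain ⟨A, rfl⟩ : ∃ A : cs.standardParabolic (Set.range e), A.1 = a := ⟨⟨a, haK⟩, rfl⟩
  have hAj := (hφ.mem_iff cs j A).1 ha
  have hm' : z⁻¹ * m * z = ((A⁻¹ * G : cs.standardParabolic (Set.range e)) : W) * b⁻¹ := by
    have h3 : m = v⁻¹ * (z * G * z⁻¹) := by rw [hvm]; group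
    have h4 : z⁻¹ * m * z = (z⁻¹ * v * z)⁻¹ * G := by rw [h3]; group
    rw [h4, hab, mul_inv_rev, Subgroup.coe_mul, Subgroup.coe_inv, mul_assoc, mul_assoc,
      hGL _ (inv_mem hb), ← mul_assoc, ← mul_assoc,
      cs.commute_of_mem_standardParabolic hL (inv_mem A.2) (inv_mem hb)]
  -- T is the W_K-component of z⁻¹mz; uniqueness of components transfers m² = 1 and mw = wm to T² =
  -- 1 and Tp = pT.
  obtain ⟨T, hT⟩ : ∃ T, T = A⁻¹ * G := ⟨_, rfl⟩
  rw [← hT] at hm'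
  have hTL : ∀ b ∈ cs.standardParabolic L, (T : W) * b = b * T :=
    fun b hb => cs.commute_of_mem_standardParabolic hL T.2 hb
  have hTT : T * T = 1 := by
    have h3 : (T * T : W) * (b⁻¹ * b⁻¹) = 1 * 1 := by
      calc (T * T : W) * (b⁻¹ * b⁻¹) = T * (T * b⁻¹) * b⁻¹ := by group
        _ = T * (b⁻¹ * T) * b⁻¹ := by rw [hTL _ (inv_mem hb)]
        _ = (T * b⁻¹) * (T * b⁻¹) := by group
        _ = z⁻¹ * (m * m) * z := by rw [← hm']; group
        _ = 1 * 1 := by rw [hmm]; group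
    exact Subtype.ext (cs.eq_and_eq_of_mul_eq_mul hodd hn φ hL (mul_mem T.2 T.2) (one_mem _)
      (mul_mem (inv_mem hb) (inv_mem hb)) (one_mem _) h3).1
  have hTp : T * p = p * T := by
    have h3 : (T * p : W) * (b⁻¹ * q) = p * T * (q * b⁻¹) := by
      calc (T * p : W) * (b⁻¹ * q) = T * (p * b⁻¹) * q := by group
        _ = (T * b⁻¹) * (p * q) := by
          rw [cs.commute_of_mem_standardParabolic hL p.2 (inv_mem hb)]; group
        _ = z⁻¹ * (m * w) * z := by rw [← hm', hw]; group
        _ = (p * q) * (T * b⁻¹) := by rw [hm, ← hm', hw]; group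
        _ = p * (q * T) * b⁻¹ := by group
        _ = p * T * (q * b⁻¹) := by rw [← hTL q hq]; group
    exact Subtype.ext (cs.eq_and_eq_of_mul_eq_mul hodd hn φ hL (mul_mem T.2 p.2)
      (mul_mem p.2 T.2) (mul_mem (inv_mem hb) hq) (mul_mem hq (inv_mem hb)) h3).1
  obtain ⟨i, hi, hi1, hi2⟩ := hp.exists_apply_eq (τ := cs.toSignedPerm φ T)
    (by rw [← map_mul, hTT, map_one]) (cs.signProd_toSignedPerm φ T)
    (by rw [← map_mul, hTp, map_mul])
  -- At the point i fixed by T with sign +, both A and T have sign +, but G has sign -1.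
  have hGA : cs.toSignedPerm φ G = cs.toSignedPerm φ A * cs.toSignedPerm φ T := by
    rw [← map_mul, hT, mul_inv_cancel_left]
  have h3 := (hg3 i hi).2
  rw [hGA, sgn_mul, hi1, hi2, sgn_eq_one_of_mem_maximalParabolic h2 hAj
    (not_lt.1 (by rwa [← hj]))] at h3
  exact absurd h3 (by decide)

end TypeD

end CoxeterSystem

theorem mainTheorem5 {B W : Type*} [Group W] [Finite W] {M : CoxeterMatrix B}
    (cs : CoxeterSystem M W) (w : W) (hw : cs.IsNonCompliantClass (ConjClasses.mk w)) :
    (cs.HasMinimalLength w →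
      ¬ HasComplementIn
          (cs.standardParabolic (cs.generatorSupport w) ⊓ Subgroup.centralizer {w})
          (Subgroup.centralizer {w})) ∧
    ¬ HasComplementIn (cs.parabolicClosure w ⊓ Subgroup.centralizer {w})
        (Subgroup.centralizer {w}) := by
  have key : ¬ HasComplementIn (cs.parabolicClosure w ⊓ Subgroup.centralizer {w})
      (Subgroup.centralizer {w}) := by
    obtain ⟨n, hodd, hn, I, e, -, -, hI, φ, hφ, p, q, hpq, htype⟩ := hw
    obtain ⟨x, hx⟩ := isConj_iff.1 (ConjClasses.mk_eq_mk_iff_isConj.1 hpq)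
    obtain ⟨j, p', q', z, h2, hq', hz, hp', hj, hpj, hmin⟩ := cs.exists_conj_mul hodd hI hφ q.2
      (p := p) (SignedPerm.isNonCompliant_of_cycleType htype)
    refine cs.not_hasComplementIn_parabolicClosure hodd (by omega) hI hφ h2 hq' (z := x * z) ?_
      hp' hj hpj hmin
    rw [← hx, hz]
    group
  refine ⟨fun hmin => ?_, key⟩
  rwa [← hmin.parabolicClosure_eq cs]
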